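/- For a finite group $G$ let $\mathrm{cs}(G)=\{|x^G| : x\in G\}$ denote the set of sizes of the conjugacy classes of $G$. Let $\alpha\ge 1$ be an integer. (i) There exists a finite group $G$ with $\mathrm{cs}(G)=\{1,2^{\alpha},2^{\alpha+1},2^{\alpha}\cdot 3\}$ if and only if $\alpha=1$. (ii) There exists a finite group $G$ with $\mathrm{cs}(G)=\{1,2^{\alpha},2^{\alpha+1},2^{\alpha}\cdot 3,2^{\alpha+2}\}$ and $\alpha$ odd if and only if $\alpha=1$. Moreover, for $\alpha=1$: every finite group $G$ with $\mathrm{cs}(G)=\{1,2,4,6\}$ has a normal Sylow $3$-subgroup, and every finite group $G$ with $\mathrm{cs}(G)=\{1,2,4,6,8\}$ has a normal Sylow $2$-subgroup. -/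

import Mathlib

universe u

/-- `cs G`: the set of conjugacy class sizes of the (finite) group `G`. -/
def cs (G : Type*) [Group G] : Set ℕ :=
  Set.range fun x : G => (conjugatesOf x).ncard

/-!
Write `Z` for the centre, `P` for a Sylow `2`-subgroup, `O` for the `2`-core `O₂(G)`, and suppose
that every class size is `1`, `3 * 2 ^ α` (which occurs) or a power of two from `2 ^ α` to `2 ^ δ`,
where `δ` is `α + 1` or `α + 2`.

The first step determines the shape of `G`. Elements of order prime to `6` are central. By
Wielandt's criterion (`mem_normalCore_of_cl_eq`) a `2`-element outside `O` has class size
`3 * 2 ^ α`; counting its conjugates shows that it lies in exactly a third of the Sylow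
`2`-subgroups, and Burnside's orbit count then gives `e = |P : O| ≤ 2` (`card_sylow_eq`). So
`P = O⟨y⟩` with `y` of class size `3 * 2 ^ α`. A `3`-element commuting with `y` has centralizer
containing that of `y`, hence centralizes `P` by an argument in the style of Thompson's `A × B`
lemma, hence is central (`mem_center_of_mem_cent_generator`). Therefore Sylow `3`-subgroups have
order three modulo `Z`, generated by some `c` (`Frame`).

Everything is then expressed through `R`, the group of fixed points of `c` in `O`. Class sizes prime
to three are those of `r` and `r * c` with `r ∈ R`, and `cl c = 2 ^ γ = e * |O : R|`, where
`|O : R|` is a power of four. If `O = R`, then `α = 1`, Sylow `3`-subgroups are normal and `8` is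
not a class size. If `O ≠ R` and `α = 1`, either the class size `2` or `4` is missing, or `e = 1`
and `P` is normal. For `α ≥ 2`, consider the elements `w` of `O` that are central in `O` modulo `Z`.
The product of the three conjugates of `w` under `⟨c⟩` is central, so `w` commutes with `R`
(`commute_of_secondCenter`), and `w` has class size `3 * 2 ^ α` unless it is central. Comparing
orders of centralizers, once `R` is known to contain only central `w` (`mem_center_or_le`), forces
`γ = α + 2`, and that the centralizer in `O` of all such `w` has order `4 * |R|`
(`secondCentralizer_eq`). This excludes `δ = α + 1` at once. For `δ = α + 2` and `α` odd the parity
of `γ` gives `e = 2`, and then that centralizer contains the commutators of `P`, which is impossible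
(`not_of_secondCenter`). The one case in which `R` might contain noncentral `w` is `e = 2`,
`|O : R| = 4`, `α = 3`; there an element of `O` outside `R` centralizing `R` has too small a class
(`alpha_lt_three`).

The converse is witnessed by two groups of order `96`: `SplitNinetySix` and `CentralProduct`.
-/

namespace ClassSize

open Subgroup

variable {G : Type*} [Group G]

/-! ### Centralizers and elements of prime power order -/

/-- The centralizer of a single element. -/
def cent (x : G) : Subgroup G := Subgroup.centralizer {x}

theorem mem_cent {x y : G} : y ∈ cent x ↔ y * x = x * y := by
  simp [cent, Subgroup.mem_centralizer_singleton_iff]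

theorem mem_cent_comm {x y : G} : y ∈ cent x ↔ x ∈ cent y := by
  rw [mem_cent, mem_cent, eq_comm]

theorem mem_cent_self (x : G) : x ∈ cent x := mem_cent.2 rfl

theorem mem_center_iff_cent {z : G} : z ∈ center G ↔ ∀ g, z ∈ cent g := by
  simp only [Subgroup.mem_center_iff, mem_cent]
  exact forall_congr' fun g => eq_comm

theorem center_le_cent (x : G) : center G ≤ cent x := fun _ hz => mem_center_iff_cent.1 hz x

theorem mem_cent_of_center {z : G} (hz : z ∈ center G) (g : G) : g ∈ cent z :=
  mem_cent_comm.1 (mem_center_iff_cent.1 hz g)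

theorem mem_cent_iff_conj {x y : G} : y ∈ cent x ↔ y * x * y⁻¹ = x := by
  rw [mem_cent, mul_inv_eq_iff_eq_mul]

theorem conj_mem_cent {x y : G} (h : G) (hy : y ∈ cent x) : h * y * h⁻¹ ∈ cent (h * x * h⁻¹) := by
  rw [mem_cent] at *
  simp only [mul_assoc, inv_mul_cancel_left]
  rw [← mul_assoc y, hy, mul_assoc]

theorem zpowers_le_cent (x : G) : zpowers x ≤ cent x := by
  rw [zpowers_le]; exact mem_cent_self x

theorem cent_le_of_mem_zpowers {x y : G} (h : x ∈ zpowers y) : cent y ≤ cent x := by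
  intro g hg
  rw [mem_cent_comm] at hg ⊢
  exact (zpowers_le.2 hg) h

/-- The size of the conjugacy class of `x`, as the index of the centralizer. -/
noncomputable def cl (x : G) : ℕ := (cent x).index

/-- Orbit–stabilizer for the conjugation action of a subgroup. -/
theorem ncard_conj_mul [Finite G] (H : Subgroup G) (x : G) :
    ((fun h => h * x * h⁻¹) '' (H : Set G)).ncard * Nat.card (H ⊓ cent x : Subgroup G)
      = Nat.card H := by
  have key : ∀ a b : H, (QuotientGroup.mk a : H ⧸ (cent x).subgroupOf H) = QuotientGroup.mk b ↔
      (a : G) * x * (a : G)⁻¹ = b * x * (b : G)⁻¹ := by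
    intro a b
    rw [QuotientGroup.eq, mem_subgroupOf, mem_cent_iff_conj]
    simp only [coe_mul, coe_inv, mul_inv_rev, inv_inv]
    constructor <;> intro h
    · nth_rewrite 1 [← h]; group
    · have : (a : G)⁻¹ * b * x * ((b : G)⁻¹ * a) = (a : G)⁻¹ * (b * x * (b : G)⁻¹) * a := by group
      rw [this, ← h]; group
  have h1 : ((fun h => h * x * h⁻¹) '' (H : Set G)).ncard = (cent x).relIndex H := by
    rw [relIndex, index, ← Nat.card_coe_set_eq]
    refine (Nat.card_congr (Equiv.ofBijective (Quotient.lift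
      (fun a : H => (⟨(a : G) * x * (a : G)⁻¹, a, a.2, rfl⟩ :
        ((fun h => h * x * h⁻¹) '' (H : Set G) : Set G)))
      (fun a b hab => Subtype.ext ((key a b).1 (Quotient.sound hab)))) ⟨?_, ?_⟩)).symm
    · rintro ⟨a⟩ ⟨b⟩ hab
      exact (key a b).2 (congrArg Subtype.val hab)
    · rintro ⟨_, a, ha, rfl⟩
      exact ⟨QuotientGroup.mk ⟨a, ha⟩, rfl⟩
  rw [h1, ← inf_relIndex_right, mul_comm, inf_comm (cent x)]
  have := relIndex_mul_relIndex ⊥ (H ⊓ cent x) H bot_le inf_le_left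
  rwa [relIndex_bot_left, relIndex_bot_left] at this

theorem ncard_conjugatesOf [Finite G] (x : G) : (conjugatesOf x).ncard = cl x := by
  have h := ncard_conj_mul (⊤ : Subgroup G) x
  have h2 : ((fun h => h * x * h⁻¹) '' ((⊤ : Subgroup G) : Set G)) = conjugatesOf x := by
    ext y
    change _ ↔ IsConj x y
    rw [isConj_iff]
    simp
  rw [h2, top_inf_eq, Nat.card_congr topEquiv.toEquiv, ← (cent x).index_mul_card] at h
  exact Nat.eq_of_mul_eq_mul_right Nat.card_pos h

theorem cl_eq_one_iff {x : G} : cl x = 1 ↔ x ∈ center G := by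
  rw [cl, index_eq_one, mem_center_iff_cent]
  constructor
  · intro h g; rw [mem_cent_comm, h]; trivial
  · intro h; rw [eq_top_iff]; intro g _; exact mem_cent_comm.1 (h g)

theorem cl_pos [Finite G] (x : G) : 0 < cl x := Nat.pos_of_ne_zero index_ne_zero_of_finite

theorem cl_dvd_of_cent_le {x y : G} (h : cent y ≤ cent x) : cl x ∣ cl y := index_dvd_of_le h

theorem cent_eq_of_le [Finite G] {x y : G} (h : cent y ≤ cent x) (h2 : cl y ∣ cl x) :
    cent y = cent x := by
  have h3 := relIndex_mul_index h
  have h4 := Nat.dvd_antisymm h2 (cl_dvd_of_cent_le h)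
  unfold cl at h4
  have : 0 < (cent x).index := cl_pos x
  have h5 : (cent y).relIndex (cent x) = 1 := by
    rw [h4] at h3
    exact Nat.eq_of_mul_eq_mul_right this (by rw [h3, one_mul])
  exact le_antisymm h (relIndex_eq_one.1 h5)

theorem cent_conj (h x : G) : cent (h * x * h⁻¹) = (cent x).map (MulAut.conj h).toMonoidHom := by
  ext y
  rw [mem_map_equiv, MulAut.conj_symm_apply]
  constructor
  · intro hy
    have := conj_mem_cent h⁻¹ hy
    simpa [mul_assoc] using this
  · intro hy
    have := conj_mem_cent h hy
    simpa [mul_assoc] using this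

theorem cl_conj (h x : G) : cl (h * x * h⁻¹) = cl x := by
  rw [cl, cl, cent_conj]
  exact index_map_of_bijective (MulAut.conj h).bijective _

theorem cent_mul_center (x : G) {z : G} (hz : z ∈ center G) : cent (x * z) = cent x := by
  ext g
  have h : g * z = z * g := mem_cent.1 (mem_cent_of_center hz g)
  rw [mem_cent, mem_cent, ← mul_assoc, mul_assoc x z g, ← h, ← mul_assoc]
  exact mul_left_inj z

theorem cl_mul_center (x : G) {z : G} (hz : z ∈ center G) : cl (x * z) = cl x := by
  rw [cl, cent_mul_center x hz, cl]

/-- `x` has order a power of `p`. -/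
def IsPElem (p : ℕ) (x : G) : Prop := ∃ k, x ^ p ^ k = 1

theorem IsPElem.zpowers {p : ℕ} {x : G} (h : IsPElem p x) : IsPGroup p (zpowers x) := by
  obtain ⟨k, hk⟩ := h
  rintro ⟨_, j, rfl⟩
  refine ⟨k, Subtype.ext ?_⟩
  simp only [SubmonoidClass.coe_pow, OneMemClass.coe_one]
  rw [← zpow_natCast, ← zpow_mul, mul_comm, zpow_mul, zpow_natCast, hk, one_zpow]

theorem _root_.IsPGroup.isPElem {p : ℕ} {H : Subgroup G} (hH : IsPGroup p H) {x : G} (hx : x ∈ H) :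
    IsPElem p x := by
  obtain ⟨k, hk⟩ := hH ⟨x, hx⟩
  exact ⟨k, congrArg Subtype.val hk⟩

theorem IsPElem.conj {p : ℕ} {x : G} (h : IsPElem p x) (g : G) : IsPElem p (g * x * g⁻¹) := by
  obtain ⟨k, hk⟩ := h
  exact ⟨k, by rw [conj_pow, hk]; simp⟩

theorem IsPElem.of_mem_zpowers {p : ℕ} {x y : G} (h : IsPElem p x) (hy : y ∈ Subgroup.zpowers x) :
    IsPElem p y := h.zpowers.isPElem hy

theorem IsPElem.mul {p : ℕ} {x y : G} (hx : IsPElem p x) (hy : IsPElem p y) (h : x ∈ cent y) :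
    IsPElem p (x * y) := by
  obtain ⟨k, hk⟩ := hx
  obtain ⟨l, hl⟩ := hy
  refine ⟨k + l, ?_⟩
  have hc : Commute x y := mem_cent.1 h
  rw [hc.mul_pow, pow_add, pow_mul, hk, one_pow, mul_comm, pow_mul, hl, one_pow, one_mul]

theorem IsPElem.inv {p : ℕ} {x : G} (hx : IsPElem p x) : IsPElem p x⁻¹ :=
  hx.of_mem_zpowers (inv_mem (mem_zpowers x))

theorem eq_one_of_pow_coprime {x : G} {m n : ℕ} (hm : x ^ m = 1) (hn : x ^ n = 1)
    (h : Nat.Coprime m n) : x = 1 := by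
  have := orderOf_dvd_of_pow_eq_one hm
  have h2 := orderOf_dvd_of_pow_eq_one hn
  exact orderOf_eq_one_iff.1 (Nat.eq_one_of_dvd_coprimes h this h2)

theorem IsPElem.eq_one {p q : ℕ} (hpq : Nat.Coprime p q) {x : G} (hp : IsPElem p x)
    (hq : IsPElem q x) : x = 1 := by
  obtain ⟨k, hk⟩ := hp
  obtain ⟨l, hl⟩ := hq
  exact eq_one_of_pow_coprime hk hl (Nat.Coprime.pow _ _ hpq)

/-- For commuting elements of coprime orders the centralizer of the product is the intersection
of the centralizers. -/
theorem cent_mul_of_coprime {x y : G} {m n : ℕ} (hm : x ^ m = 1) (hn : y ^ n = 1)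
    (h : Nat.Coprime m n) (hxy : x ∈ cent y) : cent (x * y) = cent x ⊓ cent y := by
  have hc : Commute x y := mem_cent.1 hxy
  have key : ∀ {x y : G} {m n : ℕ}, (x : G) ^ m = 1 → y ^ n = 1 → Nat.Coprime m n → Commute x y →
      x ∈ zpowers (x * y) := by
    intro x y m n hm hn h hc
    have h1 : (x * y) ^ n = x ^ n := by rw [hc.mul_pow, hn, mul_one]
    have h2 : (x ^ n) ^ (Nat.gcdB m n) = x := by
      have := Nat.gcd_eq_gcd_ab m n
      rw [h.gcd_eq_one] at this
      have h3 : x ^ ((m : ℤ) * Nat.gcdA m n + n * Nat.gcdB m n) = x := by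
        rw [← this]; simp
      rw [zpow_add, zpow_mul, zpow_natCast, hm, one_zpow, one_mul, zpow_mul, zpow_natCast] at h3
      exact h3
    rw [← h1] at h2
    exact ⟨n * Nat.gcdB m n, by simpa only [zpow_mul, zpow_natCast] using h2⟩
  apply le_antisymm
  · refine le_inf (cent_le_of_mem_zpowers (key hm hn h hc)) (cent_le_of_mem_zpowers ?_)
    rw [hc.eq]
    exact key hn hm h.symm hc.symm
  · rintro g ⟨hx, hy⟩
    have hx := mem_cent.1 hx
    have hy := mem_cent.1 hy
    rw [mem_cent, ← mul_assoc, hx, mul_assoc, hy, mul_assoc]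

theorem cent_mul_of_isPElem {x y : G} (hx : IsPElem 2 x) (hy : IsPElem 3 y) (hxy : x ∈ cent y) :
    cent (x * y) = cent x ⊓ cent y := by
  obtain ⟨k, hk⟩ := hx
  obtain ⟨l, hl⟩ := hy
  exact cent_mul_of_coprime hk hl (Nat.Coprime.pow _ _ (by norm_num)) hxy

/-- Splitting off the `p`-part of an element of finite order. -/
theorem exists_pPart [Finite G] (p : ℕ) [hp : Fact p.Prime] (g : G) :
    ∃ a b : G, a ∈ zpowers g ∧ b ∈ zpowers g ∧ g = a * b ∧ IsPElem p a ∧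
      ∃ m, b ^ m = 1 ∧ Nat.Coprime p m ∧ m ∣ orderOf g := by
  obtain ⟨k, m, hm, hk⟩ := Nat.exists_eq_pow_mul_and_not_dvd (orderOf_pos g).ne' p hp.out.ne_one
  have hcop : Nat.Coprime (p ^ k) m := Nat.Coprime.pow_left _ ((hp.out.coprime_iff_not_dvd).2 hm)
  have hb := Nat.gcd_eq_gcd_ab (p ^ k) m
  rw [hcop.gcd_eq_one] at hb
  have hg : g ^ ((p ^ k : ℕ) * m) = 1 := by rw [← hk]; exact pow_orderOf_eq_one g
  refine ⟨g ^ ((m : ℤ) * Nat.gcdB (p ^ k) m), g ^ (((p ^ k : ℕ) : ℤ) * Nat.gcdA (p ^ k) m),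
    zpow_mem (mem_zpowers _) _, zpow_mem (mem_zpowers _) _, ?_, ⟨k, ?_⟩, m, ?_,
    (hp.out.coprime_iff_not_dvd).2 hm, hk ▸ Dvd.intro_left _ rfl⟩
  · rw [← zpow_add, add_comm, ← hb]; simp
  · rw [← zpow_natCast, ← zpow_mul, mul_comm, ← mul_assoc, zpow_mul, ← Nat.cast_mul, zpow_natCast,
      hg, one_zpow]
  · rw [← zpow_natCast, ← zpow_mul, mul_comm, ← mul_assoc, zpow_mul, mul_comm, ← Nat.cast_mul,
      zpow_natCast, hg, one_zpow]

/-! ### Sylow subgroups and class sizes -/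

theorem exists_pSubgroup_card_eq [Finite G] (p : ℕ) [Fact p.Prime] (H : Subgroup G) :
    ∃ T ≤ H, IsPGroup p T ∧ Nat.card T = p ^ (Nat.card H).factorization p := by
  obtain ⟨S⟩ : Nonempty (Sylow p H) := inferInstance
  refine ⟨(S : Subgroup H).map H.subtype, map_subtype_le _, S.2.map _, ?_⟩
  rw [card_map_of_injective H.subtype_injective]
  exact S.card_eq_multiplicity

theorem pSubgroup_card_dvd [Finite G] {p : ℕ} [Fact p.Prime] {H T : Subgroup G}
    (hT : IsPGroup p T) (hTH : T ≤ H) : Nat.card T ∣ p ^ (Nat.card H).factorization p := by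
  obtain ⟨k, hk⟩ := hT.exists_card_eq
  have := card_dvd_of_le hTH
  rw [hk] at this ⊢
  exact pow_dvd_pow p (((Fact.out : p.Prime).pow_dvd_iff_le_factorization
    Nat.card_pos.ne').1 this)

/-- The `p`-part of `|G| = |C(x)| * |G : C(x)|`. -/
theorem card_sylow_eq_mul [Finite G] {p : ℕ} [Fact p.Prime] (P : Sylow p G) (x : G) :
    p ^ (Nat.card (cent x)).factorization p * p ^ (cl x).factorization p = Nat.card P := by
  rw [P.card_eq_multiplicity, ← pow_add, ← (cent x).card_mul_index,
    Nat.factorization_mul Nat.card_pos.ne' index_ne_zero_of_finite]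
  rfl

/-- A `p`-subgroup centralizing `x` bounds the `p`-part of the class size of `x`. -/
theorem card_mul_pPart_dvd [Finite G] {p : ℕ} [Fact p.Prime] (P : Sylow p G) {x : G}
    {T : Subgroup G} (hT : IsPGroup p T) (hx : T ≤ cent x) :
    Nat.card T * p ^ (cl x).factorization p ∣ Nat.card P := by
  rw [← card_sylow_eq_mul P x]
  exact mul_dvd_mul_right (pSubgroup_card_dvd hT hx) _

theorem exists_sylow_cent [Finite G] {p : ℕ} [Fact p.Prime] (P : Sylow p G) (x : G) :
    ∃ T ≤ cent x, IsPGroup p T ∧ Nat.card T * p ^ (cl x).factorization p = Nat.card P := by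
  obtain ⟨T, h1, h2, h3⟩ := exists_pSubgroup_card_eq p (cent x)
  exact ⟨T, h1, h2, by rw [h3, card_sylow_eq_mul]⟩

/-- Equality in `card_mul_pPart_dvd`, when `T` contains all `p`-elements of the centralizer of `x`.
-/
theorem card_mul_pPart_eq [Finite G] {p : ℕ} [Fact p.Prime] (P : Sylow p G) {x : G}
    {T : Subgroup G} (hT : IsPGroup p T) (hx : T ≤ cent x)
    (hall : ∀ a ∈ cent x, IsPElem p a → a ∈ T) :
    Nat.card T * p ^ (cl x).factorization p = Nat.card P := by
  obtain ⟨S, h1, h2, h3⟩ := exists_sylow_cent P x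
  have hST : S ≤ T := fun a ha => hall a (h1 ha) (h2.isPElem ha)
  apply Nat.dvd_antisymm (card_mul_pPart_dvd P hT hx)
  rw [← h3]
  exact mul_dvd_mul_right (card_dvd_of_le hST) _

theorem exists_conj_le_sylow [Finite G] {p : ℕ} [Fact p.Prime] (P : Sylow p G) {T : Subgroup G}
    (hT : IsPGroup p T) : ∃ g : G, ∀ t ∈ T, g * t * g⁻¹ ∈ P := by
  obtain ⟨S, hS⟩ := hT.exists_le_sylow
  obtain ⟨g, hg⟩ := MulAction.exists_smul_eq G S P
  refine ⟨g, fun t ht => ?_⟩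
  rw [← hg]
  exact Subgroup.smul_mem_pointwise_smul t (MulAut.conj g) _ (hS ht)

theorem exists_conj_le_sylow_of_card [Finite G] {p : ℕ} [Fact p.Prime] (P : Sylow p G)
    {T : Subgroup G} (hT : IsPGroup p T) (hc : Nat.card T = Nat.card P) :
    ∃ g : G, ∀ t ∈ P, g * t * g⁻¹ ∈ T := by
  obtain ⟨g, hg⟩ := exists_conj_le_sylow P hT
  refine ⟨g⁻¹, fun t ht => ?_⟩
  have h1 : T.map (MulAut.conj g).toMonoidHom = P := by
    apply eq_of_le_of_card_ge
    · rintro _ ⟨t, ht, rfl⟩; exact hg t ht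
    · rw [card_map_of_injective (MulAut.conj g).injective, hc]
  have ht : t ∈ (P : Subgroup G) := ht
  rw [← h1] at ht
  obtain ⟨s, hs, rfl⟩ := ht
  simpa [mul_assoc] using hs

theorem IsPElem.exists_conj_mem [Finite G] {p : ℕ} [Fact p.Prime] (P : Sylow p G) {x : G}
    (hx : IsPElem p x) : ∃ g : G, g * x * g⁻¹ ∈ P := by
  obtain ⟨g, hg⟩ := exists_conj_le_sylow P hx.zpowers
  exact ⟨g, hg x (mem_zpowers x)⟩

/-- If `p` does not divide the class size of `x`, then `x` centralizes a conjugate of `P`. -/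
theorem exists_conj_sylow_le_cent [Finite G] {p : ℕ} [Fact p.Prime] (P : Sylow p G) {x : G}
    (hx : ¬ p ∣ cl x) : ∃ g : G, ∀ t ∈ P, t ∈ cent (g * x * g⁻¹) := by
  obtain ⟨T, h1, h2, h3⟩ := exists_sylow_cent P x
  rw [Nat.factorization_eq_zero_of_not_dvd hx, pow_zero, mul_one] at h3
  obtain ⟨g, hg⟩ := exists_conj_le_sylow_of_card P h2 h3
  refine ⟨g⁻¹, fun t ht => ?_⟩
  have := conj_mem_cent g⁻¹ (h1 (hg t ht))
  simpa [mul_assoc] using this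

theorem not_dvd_cl_of_sylow_le [Finite G] {p : ℕ} [Fact p.Prime] (P : Sylow p G) {x : G}
    (hx : (P : Subgroup G) ≤ cent x) : ¬ p ∣ cl x := by
  intro hd
  have := card_mul_pPart_dvd P P.2 hx
  have h2 := Nat.le_of_dvd Nat.card_pos this
  have h3 : 1 < p ^ (cl x).factorization p := Nat.one_lt_pow
    (((Fact.out : p.Prime).factorization_pos_of_dvd (cl_pos x).ne' hd).ne')
    (Fact.out : p.Prime).one_lt
  have h4 : 0 < Nat.card P := Nat.card_pos
  change Nat.card P * _ ≤ Nat.card P at h2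
  nlinarith

/-- A central `p`-element lies in every Sylow `p`-subgroup. -/
theorem mem_sylow_of_center [Finite G] {p : ℕ} [Fact p.Prime] (P : Sylow p G) {z : G}
    (hz : z ∈ center G) (h : IsPElem p z) : z ∈ P := by
  obtain ⟨g, hg⟩ := h.exists_conj_mem P
  rwa [mem_cent_iff_conj.1 (mem_cent_of_center hz g)] at hg

/-- A finite group is not the union of the conjugates of a proper subgroup. -/
theorem eq_top_of_conj_cover [Finite G] (H : Subgroup G) (h : ∀ g : G, ∃ k : G, k * g * k⁻¹ ∈ H) :
    H = ⊤ := by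
  classical
  have := Fintype.ofFinite G
  have : Fintype (G ⧸ H) := Fintype.ofFinite _
  have : Fintype (Quotient (MulAction.orbitRel G (G ⧸ H))) := Fintype.ofFinite _
  have key := MulAction.sum_card_fixedBy_eq_card_orbits_mul_card_group G (G ⧸ H)
  have h1 : Fintype.card (Quotient (MulAction.orbitRel G (G ⧸ H))) = 1 := by
    rw [Fintype.card_eq_one_iff_nonempty_unique]
    exact (MulAction.pretransitive_iff_unique_quotient_of_nonempty G (G ⧸ H)).1 inferInstance
  rw [h1, one_mul] at key
  have h2 : ∀ g : G, 1 ≤ Fintype.card (MulAction.fixedBy (G ⧸ H) g) := by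
    intro g
    obtain ⟨k, hk⟩ := h g
    refine Fintype.card_pos_iff.2 ⟨⟨(QuotientGroup.mk k⁻¹ : G ⧸ H), ?_⟩⟩
    rw [MulAction.mem_fixedBy, MulAction.Quotient.smul_mk, QuotientGroup.eq]
    simpa [mul_assoc] using H.inv_mem hk
  have h3 : Fintype.card (MulAction.fixedBy (G ⧸ H) (1 : G)) = Fintype.card (G ⧸ H) := by
    exact Fintype.card_congr ((Equiv.setCongr (MulAction.fixedBy_one_eq_univ _ _)).trans
      (Equiv.Set.univ _))
  have h4 := Finset.add_sum_erase Finset.univ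
    (fun g : G => Fintype.card (MulAction.fixedBy (G ⧸ H) g)) (Finset.mem_univ 1)
  have h5 : (Finset.univ.erase (1 : G)).card • 1 ≤ ∑ g ∈ Finset.univ.erase (1 : G),
      Fintype.card (MulAction.fixedBy (G ⧸ H) g) := Finset.card_nsmul_le_sum _ _ _ (fun g _ => h2 g)
  rw [key, h3] at h4
  rw [Finset.card_erase_of_mem (Finset.mem_univ _), Finset.card_univ, smul_eq_mul, mul_one] at h5
  have h6 : 0 < Fintype.card G := Fintype.card_pos
  have h7 : 0 < Fintype.card (G ⧸ H) := Fintype.card_pos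
  rw [← index_eq_one, index, Nat.card_eq_fintype_card]
  omega

/-- An element of `p`-power order acting by conjugation on a set fixes `|S|` points modulo `p`. -/
theorem ncard_modEq_fixed [Finite G] {p : ℕ} [Fact p.Prime] {c : G} (hc : IsPElem p c) (S : Set G)
    (hS : ∀ x ∈ S, c * x * c⁻¹ ∈ S) : S.ncard ≡ (S ∩ cent c : Set G).ncard [MOD p] := by
  classical
  obtain ⟨k, hk⟩ := hc
  have : Fintype S := Fintype.ofFinite _
  let f : Function.End S := fun x => ⟨c * x * c⁻¹, hS x x.2⟩
  have hf : ∀ n : ℕ, ∀ x : S, ((f ^ n) x : G) = c ^ n * x * (c ^ n)⁻¹ := by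
    intro n
    induction n with
    | zero => intro x; simp only [pow_zero, one_mul, inv_one, mul_one]; rfl
    | succ n ih =>
      intro x
      rw [pow_succ]
      change ((f ^ n) (f x) : G) = _
      rw [ih]
      simp [f, pow_succ, mul_assoc]
  have hf1 : f ^ p ^ k = 1 := by
    funext x
    apply Subtype.ext
    rw [hf, hk, one_mul, inv_one, mul_one]; rfl
  have := Equiv.Perm.card_fixedPoints_modEq hf1
  rw [← Nat.card_coe_set_eq, ← Nat.card_coe_set_eq, Nat.card_eq_fintype_card]
  convert this using 1
  rw [← Nat.card_eq_fintype_card]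
  refine Nat.card_congr ⟨fun x => ⟨⟨x, x.2.1⟩, ?_⟩, fun x => ⟨x.1.1, x.1.2, ?_⟩, fun x => rfl,
    fun x => rfl⟩
  · apply Subtype.ext
    exact mem_cent_iff_conj.1 (mem_cent_comm.1 x.2.2)
  · have h : f x.1 = x.1 := x.2
    exact mem_cent_comm.1 (mem_cent_iff_conj.2 (congrArg Subtype.val h))

/-- A normal subgroup of a finite `p`-group that is not central contains a noncentral element that
is central modulo the centre. -/
theorem exists_secondCenter [Finite G] {p : ℕ} [Fact p.Prime] (hG : IsPGroup p G)
    (N : Subgroup G) [N.Normal] (hN : ¬ N ≤ center G) :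
    ∃ w ∈ N, w ∉ center G ∧ ∀ u : G, w * u * w⁻¹ * u⁻¹ ∈ center G := by
  classical
  have hnil := hG.isNilpotent
  obtain ⟨n, hn⟩ := hnil.nilpotent'
  have hex : ∃ i, ¬ N ⊓ Subgroup.upperCentralSeries G i ≤ center G := ⟨n, by rwa [hn, inf_top_eq]⟩
  obtain ⟨w, hw, hwc⟩ := SetLike.not_le_iff_exists.1 (Nat.find_spec hex)
  have hmin : ∀ j < Nat.find hex, N ⊓ Subgroup.upperCentralSeries G j ≤ center G :=
    fun j hj => not_not.1 (Nat.find_min hex hj)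
  refine ⟨w, hw.1, hwc, fun u => ?_⟩
  rcases hi : Nat.find hex with _ | j
  · rw [hi] at hw
    exfalso
    have h1 : w ∈ Subgroup.upperCentralSeries G 0 := hw.2
    rw [Subgroup.upperCentralSeries_zero, mem_bot] at h1
    exact hwc (h1 ▸ one_mem _)
  · rw [hi] at hw
    refine hmin j (by omega) ⟨?_, Subgroup.mem_upperCentralSeries_succ_iff.1 hw.2 u⟩
    rw [mul_assoc, mul_assoc, ← mul_assoc u]
    exact mul_mem hw.1 (Normal.conj_mem inferInstance _ (inv_mem hw.1) u)

/-! ### Groups with class sizes `1`, `3 * 2 ^ α` and powers of two -/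

/-- Every class size is `1`, `3 * 2 ^ α` or a power of two between `2 ^ α` and `2 ^ δ`, and
`3 * 2 ^ α` occurs. -/
structure SizeBound (G : Type*) [Group G] (α δ : ℕ) : Prop where
  pos : 1 ≤ α
  size : ∀ x : G, cl x = 1 ∨ cl x = 3 * 2 ^ α ∨ ∃ k, α ≤ k ∧ k ≤ δ ∧ cl x = 2 ^ k
  attained : ∃ x : G, cl x = 3 * 2 ^ α

theorem factorization_two_three_mul (k : ℕ) : (3 * 2 ^ k).factorization 2 = k := by
  rw [Nat.factorization_mul (by norm_num) (by positivity), Nat.Prime.factorization_pow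
    Nat.prime_two, Nat.Prime.factorization Nat.prime_three]
  simp

theorem factorization_three_three_mul (k : ℕ) : (3 * 2 ^ k).factorization 3 = 1 := by
  rw [Nat.factorization_mul (by norm_num) (by positivity), Nat.Prime.factorization_pow
    Nat.prime_two, Nat.Prime.factorization Nat.prime_three]
  simp

theorem factorization_two_pow (k : ℕ) : (2 ^ k).factorization 2 = k := by
  rw [Nat.Prime.factorization_pow Nat.prime_two]; simp

theorem not_three_dvd_two_pow (k : ℕ) : ¬ 3 ∣ 2 ^ k := fun h => by
  have := Nat.Prime.dvd_of_dvd_pow Nat.prime_three h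
  omega

namespace SizeBound

variable {α δ : ℕ}

theorem eq_of_three_dvd (h : SizeBound G α δ) {x : G} (hx : 3 ∣ cl x) : cl x = 3 * 2 ^ α := by
  rcases h.size x with h1 | h1 | ⟨k, _, _, h1⟩
  · omega
  · exact h1
  · exact absurd (h1 ▸ hx) (not_three_dvd_two_pow k)

theorem eq_of_not_three_dvd (h : SizeBound G α δ) {x : G} (hx : ¬ 3 ∣ cl x) :
    cl x = 1 ∨ ∃ k, α ≤ k ∧ k ≤ δ ∧ cl x = 2 ^ k := by
  rcases h.size x with h1 | h1 | h1
  · exact Or.inl h1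
  · exact absurd (h1 ▸ Dvd.intro _ rfl) hx
  · exact Or.inr h1

theorem eq_two_pow (h : SizeBound G α δ) {x : G} (hx : ¬ 3 ∣ cl x) :
    cl x = 2 ^ (cl x).factorization 2 := by
  rcases h.eq_of_not_three_dvd hx with h1 | ⟨k, _, _, h1⟩
  · rw [h1]; simp
  · rw [h1, factorization_two_pow]

theorem factorization_eq_zero_or (h : SizeBound G α δ) (x : G) :
    x ∈ center G ∨ α ≤ (cl x).factorization 2 := by
  rcases h.size x with h1 | h1 | ⟨k, h2, _, h1⟩
  · exact Or.inl (cl_eq_one_iff.1 h1)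
  · right; rw [h1, factorization_two_three_mul]
  · right; rw [h1, factorization_two_pow]; exact h2

theorem mem_center_of_not_two_dvd (h : SizeBound G α δ) {x : G} (hx : ¬ 2 ∣ cl x) :
    x ∈ center G := by
  rcases h.factorization_eq_zero_or x with h1 | h1
  · exact h1
  · rw [Nat.factorization_eq_zero_of_not_dvd hx] at h1
    have := h.pos
    omega

theorem mem_center_of_sylow_le [Finite G] (h : SizeBound G α δ) (P : Sylow 2 G) {x : G}
    (hx : (P : Subgroup G) ≤ cent x) : x ∈ center G :=
  h.mem_center_of_not_two_dvd (not_dvd_cl_of_sylow_le P hx)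

end SizeBound

/-- If no class size is divisible by `p`, every element commutes with a conjugate of `P`, so the
conjugates of `C(P)` cover `G` and `P` is central. -/
theorem sylow_le_center [Finite G] {p : ℕ} [Fact p.Prime] (h : ∀ x : G, ¬ p ∣ cl x)
    (P : Sylow p G) : (P : Subgroup G) ≤ center G := by
  have h1 : centralizer ((P : Subgroup G) : Set G) = ⊤ := by
    apply eq_top_of_conj_cover
    intro g
    obtain ⟨k, hk⟩ := exists_conj_sylow_le_cent P (h g)
    exact ⟨k, mem_centralizer_iff.2 fun t ht => mem_cent.1 (hk t ht)⟩
  rwa [centralizer_eq_top_iff_subset] at h1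

/-- Elements of order prime to `6` are central. -/
theorem SizeBound.mem_center_of_coprime [Finite G] {α δ : ℕ} (h : SizeBound G α δ) {b : G} {m : ℕ}
    (hb : b ^ m = 1) (h2 : Nat.Coprime 2 m) (h3 : Nat.Coprime 3 m) : b ∈ center G := by
  have hcop : Nat.Coprime m (center G).index := by
    apply Nat.Coprime.symm
    apply Nat.coprime_of_dvd
    intro p hp hpi hpm
    have : Fact p.Prime := ⟨hp⟩
    obtain ⟨S⟩ : Nonempty (Sylow p G) := inferInstance
    have hp2 : p ≠ 2 := by rintro rfl; exact (Nat.prime_two.coprime_iff_not_dvd.1 h2) hpm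
    have hp3 : p ≠ 3 := by rintro rfl; exact (Nat.prime_three.coprime_iff_not_dvd.1 h3) hpm
    have hS : (S : Subgroup G) ≤ center G := by
      apply sylow_le_center
      intro x hx
      have h2k : ∀ k, ¬ p ∣ 2 ^ k := fun k hk =>
        hp2 ((Nat.prime_dvd_prime_iff_eq hp Nat.prime_two).1 (hp.dvd_of_dvd_pow hk))
      rcases h.size x with h1 | h1 | ⟨k, _, _, h1⟩ <;> rw [h1] at hx
      · exact hp.one_lt.ne' (Nat.dvd_one.1 hx)
      · rcases hp.dvd_mul.1 hx with hx | hx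
        · exact hp3 ((Nat.prime_dvd_prime_iff_eq hp Nat.prime_three).1 hx)
        · exact h2k _ hx
      · exact h2k _ hx
    exact S.not_dvd_index (hpi.trans (index_dvd_of_le hS))
  -- The image of `b` in `G ⧸ center G` is killed by `m` and by the order of this group.
  have h1 : b ^ (center G).index ∈ center G := pow_index_mem (center G) b
  have hq : (QuotientGroup.mk b : G ⧸ center G) = 1 := by
    apply eq_one_of_pow_coprime (m := m) (n := (center G).index) _ _ hcop
    · rw [← QuotientGroup.mk_pow, hb]; rfl
    · rw [← QuotientGroup.mk_pow, QuotientGroup.eq_one_iff]; exact h1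
  exact (QuotientGroup.eq_one_iff b).1 hq

/-- Every element is the product of a `2`-element, a `3`-element and a central element, the first
two being powers of it. -/
theorem SizeBound.exists_decomp [Finite G] {α δ : ℕ} (h : SizeBound G α δ) (g : G) :
    ∃ x q z : G, IsPElem 2 x ∧ IsPElem 3 q ∧ z ∈ center G ∧ x ∈ zpowers g ∧ q ∈ zpowers g ∧
      g = x * q * z := by
  obtain ⟨a, b, ha, hb, hg, hpa, m, hbm, hcop, -⟩ := exists_pPart 2 g
  obtain ⟨a', b', ha', hb', hg', hpa', m', hbm', hcop', hd⟩ := exists_pPart 3 b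
  refine ⟨a, a', b', hpa, hpa', ?_, ha, zpowers_le.2 hb ha', by rw [hg, hg', mul_assoc]⟩
  refine h.mem_center_of_coprime hbm' ?_ hcop'
  exact Nat.Coprime.coprime_dvd_right (hd.trans (orderOf_dvd_of_pow_eq_one hbm)) hcop

/-- **Wielandt's criterion**: a `p`-element whose class size is a power of `p` lies in the
`p`-core. -/
theorem mem_normalCore_of_cl_eq [Finite G] {p : ℕ} [Fact p.Prime] (P : Sylow p G) {x : G}
    (hx : IsPElem p x) (hc : cl x = p ^ (cl x).factorization p) :
    x ∈ (P : Subgroup G).normalCore := by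
  obtain ⟨g, hg⟩ := hx.exists_conj_mem P
  have key : ∀ y : G, y ∈ P → cl y = p ^ (cl y).factorization p →
      y ∈ (P : Subgroup G).normalCore := by
    intro y hy hc
    have h1 := ncard_conj_mul (P : Subgroup G) y
    have h2 := card_mul_pPart_dvd P (x := y) (T := P ⊓ cent y) P.2.to_inf_left inf_le_right
    rw [← hc, ← h1, mul_comm] at h2
    have h3 := Nat.le_of_dvd (Nat.pos_of_ne_zero fun h => by
      rw [h, zero_mul] at h1
      exact (Nat.card_pos (α := P)).ne h1) (Nat.dvd_of_mul_dvd_mul_right Nat.card_pos h2)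
    rw [← ncard_conjugatesOf] at h3
    have h4 : (fun h => h * y * h⁻¹) '' (P : Set G) = conjugatesOf y := by
      apply Set.eq_of_subset_of_ncard_le _ h3
      rintro _ ⟨h, -, rfl⟩
      exact isConj_iff.2 ⟨h, rfl⟩
    intro b
    have : b * y * b⁻¹ ∈ conjugatesOf y := isConj_iff.2 ⟨b, rfl⟩
    rw [← h4] at this
    obtain ⟨h, hh, h5⟩ := this
    rw [← h5]
    exact mul_mem (mul_mem hh hy) (inv_mem hh)
  have h1 := key _ hg (by rw [cl_conj]; exact hc)
  have h2 := (normalCore_normal (P : Subgroup G)).conj_mem _ h1 g⁻¹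
  simpa [mul_assoc] using h2

/-- If `d` divides the length of every `H`-orbit in an `H`-invariant set, it divides the size of the
set. -/
theorem dvd_ncard_of_invariant [Finite G] (H : Subgroup G) (d : ℕ) (S : Set G)
    (hS : ∀ h ∈ H, ∀ x ∈ S, h * x * h⁻¹ ∈ S)
    (hd : ∀ x ∈ S, d ∣ ((fun h => h * x * h⁻¹) '' (H : Set G)).ncard) : d ∣ S.ncard := by
  induction hn : S.ncard using Nat.strong_induction_on generalizing S with
  | _ n ih =>
    subst hn
    rcases S.eq_empty_or_nonempty with rfl | ⟨x, hx⟩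
    · simp
    set T := (fun h => h * x * h⁻¹) '' (H : Set G) with hT
    have hTS : T ⊆ S := by rintro _ ⟨h, hh, rfl⟩; exact hS h hh x hx
    have hxT : x ∈ T := ⟨1, H.one_mem, by simp⟩
    have hc := Set.ncard_sdiff_add_ncard_of_subset hTS
    have hlt : (S \ T).ncard < S.ncard := by
      have : 0 < T.ncard := (Set.ncard_pos).2 ⟨x, hxT⟩
      omega
    rw [← hc]
    refine dvd_add (ih _ hlt (S \ T) ?_ (fun y hy => hd y hy.1) rfl) (hd x hx)
    rintro h hh y ⟨hy, hyT⟩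
    refine ⟨hS h hh y hy, ?_⟩
    rintro ⟨k, hk, hk2⟩
    apply hyT
    refine ⟨h⁻¹ * k, H.mul_mem (H.inv_mem hh) hk, ?_⟩
    have : y = h⁻¹ * (h * y * h⁻¹) * h := by group
    rw [this, ← hk2]
    simp [mul_assoc]

theorem two_mul_card_dvd [Finite G] {H K : Subgroup G} (hK : IsPGroup 2 K) (h : H < K) :
    2 * Nat.card H ∣ Nat.card K := by
  obtain ⟨a, ha⟩ := (hK.to_le h.le).exists_card_eq
  obtain ⟨b, hb⟩ := hK.exists_card_eq
  have h1 : Nat.card H < Nat.card K := by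
    by_contra hc
    exact h.ne (eq_of_le_of_card_ge h.le (by omega))
  rw [ha, hb] at *
  rw [mul_comm, ← pow_succ]
  exact pow_dvd_pow _ ((Nat.pow_lt_pow_iff_right (by norm_num)).1 h1)

namespace SizeBound

variable {α δ : ℕ}

theorem cl_eq_of_not_mem_core [Finite G] (h : SizeBound G α δ) (P : Sylow 2 G) {y : G}
    (hy : IsPElem 2 y) (hyO : y ∉ (P : Subgroup G).normalCore) : cl y = 3 * 2 ^ α := by
  by_cases h3 : 3 ∣ cl y
  · exact h.eq_of_three_dvd h3
  · exact absurd (mem_normalCore_of_cl_eq P hy (h.eq_two_pow h3)) hyO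

/-- If `y ∈ P` is outside the `2`-core, its `P`-orbit has length `2 ^ α` and consists of all
conjugates of `y` in `P`.  Indeed a conjugate `y'` of `y` outside `P` is not in `P ⊓ C(y')`, so its
`P`-orbit has length divisible by `2 ^ (α + 1)`, and only `3 * 2 ^ α` conjugates are available. -/
theorem conj_outside_core [Finite G] (h : SizeBound G α δ) (P : Sylow 2 G) {y : G} (hy : y ∈ P)
    (hyO : y ∉ (P : Subgroup G).normalCore) :
    (conjugatesOf y ∩ P).ncard = 2 ^ α ∧
      Nat.card ((P : Subgroup G) ⊓ cent y : Subgroup G) * 2 ^ α = Nat.card P := by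
  have hcl := h.cl_eq_of_not_mem_core P (P.2.isPElem hy) hyO
  have hX : (conjugatesOf y).ncard = 3 * 2 ^ α := by rw [ncard_conjugatesOf, hcl]
  have hconj : ∀ y' ∈ conjugatesOf y, cl y' = 3 * 2 ^ α ∧ IsPElem 2 y' := by
    intro y' hy'
    obtain ⟨g, rfl⟩ := isConj_iff.1 hy'
    exact ⟨by rw [cl_conj, hcl], (P.2.isPElem hy).conj g⟩
  have horb : ∀ y' ∈ conjugatesOf y, ∀ d, Nat.card ((P : Subgroup G) ⊓ cent y' : Subgroup G) * d ∣
      Nat.card P → d ∣ ((fun h => h * y' * h⁻¹) '' (P : Set G)).ncard := by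
    intro y' hy' d hd
    have h1 := ncard_conj_mul (P : Subgroup G) y'
    rw [← h1, mul_comm] at hd
    exact Nat.dvd_of_mul_dvd_mul_right Nat.card_pos hd
  -- Every `P`-orbit has length divisible by `2 ^ α`, and by `2 ^ (α + 1)` outside `P`.
  have hin : ∀ y' ∈ conjugatesOf y, 2 ^ α ∣ ((fun h => h * y' * h⁻¹) '' (P : Set G)).ncard := by
    intro y' hy'
    apply horb y' hy'
    have := card_mul_pPart_dvd P (x := y') (T := P ⊓ cent y') P.2.to_inf_left inf_le_right
    rwa [(hconj y' hy').1, factorization_two_three_mul] at this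
  have hout : ∀ y' ∈ conjugatesOf y \ P,
      2 ^ (α + 1) ∣ ((fun h => h * y' * h⁻¹) '' (P : Set G)).ncard := by
    rintro y' ⟨hy', hyP⟩
    apply horb y' hy'
    have hle : (P : Subgroup G) ⊓ cent y' ≤ normalizer (zpowers y' : Subgroup G) := by
      intro g hg
      exact centralizer_le_normalizer _ (mem_centralizer_iff.2 fun t ht =>
        mem_cent.1 ((zpowers_le.2 (mem_cent_comm.1 hg.2)) ht))
    have hT : IsPGroup 2 ((P : Subgroup G) ⊓ cent y' ⊔ zpowers y' : Subgroup G) :=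
      P.2.to_inf_left.to_sup_of_normal_right' (hconj y' hy').2.zpowers hle
    have hlt : (P : Subgroup G) ⊓ cent y' < (P : Subgroup G) ⊓ cent y' ⊔ zpowers y' := by
      apply lt_of_le_of_ne le_sup_left
      intro heq
      have : y' ∈ (P : Subgroup G) ⊓ cent y' := by
        rw [heq]; exact (le_sup_right (a := (P : Subgroup G) ⊓ cent y')) (mem_zpowers y')
      exact hyP this.1
    have h1 := two_mul_card_dvd hT hlt
    have h2 := card_mul_pPart_dvd P hT (sup_le inf_le_right (zpowers_le_cent y'))
    rw [(hconj y' hy').1, factorization_two_three_mul] at h2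
    refine dvd_trans ?_ h2
    rw [pow_succ, mul_comm (2 ^ α), ← mul_assoc, mul_comm _ 2]
    exact mul_dvd_mul_right h1 _
  have hYd : 2 ^ (α + 1) ∣ (conjugatesOf y \ P).ncard := by
    apply dvd_ncard_of_invariant (P : Subgroup G) _ _ _ hout
    rintro g hg x ⟨hx, hxP⟩
    refine ⟨hx.trans (isConj_iff.2 ⟨g, rfl⟩), fun hc => hxP ?_⟩
    have : g⁻¹ * (g * x * g⁻¹) * g ∈ (P : Subgroup G) := mul_mem (mul_mem (inv_mem hg) hc) hg
    have h2 : x ∈ (P : Subgroup G) := by simpa [mul_assoc] using this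
    exact h2
  have hsum := Set.ncard_inter_add_ncard_sdiff_eq_ncard (conjugatesOf y) (P : Set G)
  have hYne : (conjugatesOf y \ P).ncard ≠ 0 := by
    refine ((Set.ncard_pos).2 ?_).ne'
    have : ¬ ∀ b : G, b * y * b⁻¹ ∈ (P : Subgroup G) := hyO
    push Not at this
    obtain ⟨b, hb⟩ := this
    exact ⟨b * y * b⁻¹, isConj_iff.2 ⟨b, rfl⟩, hb⟩
  have hyin : (fun h => h * y * h⁻¹) '' (P : Set G) ⊆ conjugatesOf y ∩ P := by
    rintro _ ⟨g, hg, rfl⟩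
    exact ⟨isConj_iff.2 ⟨g, rfl⟩, mul_mem (mul_mem hg hy) (inv_mem hg)⟩
  have hle := Set.ncard_le_ncard hyin
  obtain ⟨s, hs⟩ := hYd
  obtain ⟨r, hr⟩ := hin y (isConj_iff.2 ⟨1, by simp⟩)
  have hpp : 0 < 2 ^ α := by positivity
  have h0 : ((fun h => h * y * h⁻¹) '' (P : Set G)).ncard ≠ 0 := by
    refine ((Set.ncard_pos).2 ?_).ne'
    exact ⟨_, 1, one_mem P, rfl⟩
  rw [hX, hs, pow_succ] at hsum
  rw [hs] at hYne
  rw [hr] at hle h0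
  have hs1 : s ≠ 0 := by rintro rfl; simp at hYne
  have hr1 : r ≠ 0 := by rintro rfl; simp at h0
  have hs2 : s = 1 := by
    by_contra hne
    have : 2 ≤ s := by omega
    nlinarith
  subst hs2
  have hi : (conjugatesOf y ∩ P).ncard = 2 ^ α := by omega
  refine ⟨hi, ?_⟩
  rw [hi] at hle
  have hr2 : r = 1 := by
    by_contra hne
    have : 2 ≤ r := by omega
    nlinarith
  have h1 := ncard_conj_mul (P : Subgroup G) y
  change ((fun h => h * y * h⁻¹) '' (P : Set G)).ncard * _ = _ at h1
  rw [hr, hr2, mul_one, mul_comm] at h1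
  exact h1

end SizeBound

/-! ### The index of the `2`-core in a Sylow `2`-subgroup -/

namespace SizeBound

variable {α δ : ℕ}

/-- A `p`-element fixes a Sylow `p`-subgroup under conjugation only if it lies in it. -/
theorem mem_sylow_iff_fixed [Finite G] {p : ℕ} [Fact p.Prime] (S : Sylow p G) {y : G}
    (hy : IsPElem p y) : y • S = S ↔ y ∈ S := by
  rw [Sylow.smul_eq_iff_mem_normalizer]
  constructor
  · intro h
    have h1 : zpowers y ≤ (zpowers y) ⊓ normalizer (S : Set G) := le_inf le_rfl (zpowers_le.2 h)
    have h2 := hy.zpowers.inf_normalizer_sylow S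
    exact ((h1.trans_eq h2) (mem_zpowers y)).2
  · intro h; exact le_normalizer h

/-- An element of a Sylow `2`-subgroup outside the `2`-core lies in exactly one third of all Sylow
`2`-subgroups. -/
theorem three_mul_card_fixedBy [Finite G] (h : SizeBound G α δ) (P : Sylow 2 G) {y : G}
    (hy : y ∈ P) (hyO : y ∉ (P : Subgroup G).normalCore) :
    3 * Nat.card (MulAction.fixedBy (Sylow 2 G) y) = Nat.card (Sylow 2 G) := by
  classical
  have := Fintype.ofFinite G
  have := Fintype.ofFinite (Sylow 2 G)
  have hcl := h.cl_eq_of_not_mem_core P (P.2.isPElem hy) hyO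
  have hX : (conjugatesOf y).toFinset.card = 3 * 2 ^ α := by
    rw [← hcl, ← ncard_conjugatesOf, Set.ncard_eq_toFinset_card']
  have key := Finset.sum_card_bipartiteAbove_eq_sum_card_bipartiteBelow
    (s := (conjugatesOf y).toFinset) (t := (Finset.univ : Finset (Sylow 2 G)))
    (fun x S => x ∈ S)
  have hsmul : ∀ (g x : G) (S : Sylow 2 G), g * x * g⁻¹ ∈ g • S ↔ x ∈ S := by
    intro g x S
    exact Subgroup.smul_mem_pointwise_smul_iff (a := MulAut.conj g) (S := (S : Subgroup G)) (x := x)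
  -- Count pairs `(x, S)` with `x` a conjugate of `y` in the Sylow `2`-subgroup `S`.
  have h1 : ∀ x ∈ (conjugatesOf y).toFinset,
      (Finset.univ.bipartiteAbove (fun (x : G) (S : Sylow 2 G) => x ∈ S) x).card =
        Nat.card (MulAction.fixedBy (Sylow 2 G) y) := by
    intro x hx
    rw [Set.mem_toFinset] at hx
    obtain ⟨g, rfl⟩ := isConj_iff.1 hx
    rw [Nat.card_eq_fintype_card, Fintype.card_subtype]
    symm
    apply Finset.card_bij (fun S _ => g • S)
    · intro S hS
      simp only [Finset.mem_filter, Finset.mem_univ, true_and, MulAction.mem_fixedBy,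
        Finset.mem_bipartiteAbove] at hS ⊢
      rw [hsmul]
      exact (mem_sylow_iff_fixed S (P.2.isPElem hy)).1 hS
    · intro S _ S' _ hSS
      exact MulAction.injective g hSS
    · intro S hS
      simp only [Finset.mem_filter, Finset.mem_univ, true_and, MulAction.mem_fixedBy,
        Finset.mem_bipartiteAbove] at hS ⊢
      refine ⟨g⁻¹ • S, ?_, smul_inv_smul g S⟩
      rw [mem_sylow_iff_fixed _ (P.2.isPElem hy), ← hsmul g, smul_inv_smul]
      exact hS
  have h2 : ∀ S ∈ (Finset.univ : Finset (Sylow 2 G)),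
      ((conjugatesOf y).toFinset.bipartiteBelow (fun x S => x ∈ S) S).card = 2 ^ α := by
    intro S _
    obtain ⟨g, rfl⟩ := MulAction.exists_smul_eq G P S
    rw [← (h.conj_outside_core P hy hyO).1, Set.ncard_eq_toFinset_card']
    symm
    apply Finset.card_bij (fun x _ => g * x * g⁻¹)
    · intro x hx
      simp only [Set.mem_toFinset, Finset.mem_bipartiteBelow] at hx ⊢
      exact ⟨hx.1.trans (isConj_iff.2 ⟨g, rfl⟩), (hsmul g x P).2 hx.2⟩
    · intro x _ x' _ hxx
      simpa using hxx
    · intro x hx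
      simp only [Set.mem_toFinset, Finset.mem_bipartiteBelow] at hx ⊢
      refine ⟨g⁻¹ * x * g, ⟨hx.1.trans (isConj_iff.2 ⟨g⁻¹, by simp⟩), ?_⟩, by simp [mul_assoc]⟩
      have := hx.2
      rw [← hsmul g⁻¹, inv_smul_smul] at this
      simpa using this
  rw [Finset.sum_congr rfl h1, Finset.sum_congr rfl h2, Finset.sum_const, Finset.sum_const, hX,
    Finset.card_univ, ← Nat.card_eq_fintype_card, smul_eq_mul, smul_eq_mul] at key
  have hpp : 0 < 2 ^ α := by positivity
  apply Nat.eq_of_mul_eq_mul_right hpp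
  rw [← key]; ring

/-- The `2`-core has index at most two in a Sylow `2`-subgroup `P`. Burnside's orbit count for `P`
acting on the `n` Sylow `2`-subgroups, with `n` fixed points for elements of the `2`-core and
`n / 3` for the others, shows that the index divides `2 * n`, and `n` is odd. -/
theorem card_sylow_eq [Finite G] (h : SizeBound G α δ) (P : Sylow 2 G) :
    ∃ e, (e = 1 ∨ e = 2) ∧ Nat.card P = e * Nat.card (P : Subgroup G).normalCore := by
  classical
  have := Fintype.ofFinite G
  have := Fintype.ofFinite (Sylow 2 G)
  have : Fintype P := Fintype.ofFinite _
  have : Fintype (Quotient (MulAction.orbitRel P (Sylow 2 G))) := Fintype.ofFinite _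
  have hB := MulAction.sum_card_fixedBy_eq_card_orbits_mul_card_group P (Sylow 2 G)
  set n := Nat.card (Sylow 2 G) with hn
  set O := (P : Subgroup G).normalCore with hO
  have hOP : O ≤ P := normalCore_le _
  have h1 : ∀ g : (P : Subgroup G), 3 * Fintype.card (MulAction.fixedBy (Sylow 2 G) g) =
      n + if (g : G) ∈ O then 2 * n else 0 := by
    intro g
    have hg : Fintype.card (MulAction.fixedBy (Sylow 2 G) g) =
      Nat.card (MulAction.fixedBy (Sylow 2 G) (g : G)) := by
      rw [← Nat.card_eq_fintype_card]; rfl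
    rw [hg]
    split_ifs with hgO
    · have : MulAction.fixedBy (Sylow 2 G) (g : G) = Set.univ := by
        ext S
        simp only [MulAction.mem_fixedBy, Set.mem_univ, iff_true]
        rw [mem_sylow_iff_fixed S (P.2.isPElem g.2)]
        obtain ⟨k, rfl⟩ := MulAction.exists_smul_eq G P S
        have h2 := (normalCore_normal (P : Subgroup G)).conj_mem _ hgO k⁻¹
        have h3 := Subgroup.smul_mem_pointwise_smul _ (MulAut.conj k) (P : Subgroup G) (hOP h2)
        have h4 : MulAut.conj k • (k⁻¹ * (g : G) * k⁻¹⁻¹) = g := by simp [mul_assoc]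
        rw [h4] at h3
        exact h3
      rw [this, Nat.card_coe_set_eq, Set.ncard_univ]
      omega
    · rw [add_zero]; exact h.three_mul_card_fixedBy P g.2 hgO
  have h2 : ∑ g : (P : Subgroup G), (3 * Fintype.card (MulAction.fixedBy (Sylow 2 G) g)) =
      Nat.card P * n + Nat.card O * (2 * n) := by
    rw [Finset.sum_congr rfl (fun g _ => h1 g), Finset.sum_add_distrib, Finset.sum_const,
      Finset.card_univ, smul_eq_mul, ← Nat.card_eq_fintype_card, ← Finset.sum_filter,
      Finset.sum_const, smul_eq_mul]
    congr 2
    rw [← Fintype.card_subtype, ← Nat.card_eq_fintype_card]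
    exact Nat.card_congr (subgroupOfEquivOfLe hOP).toEquiv
  rw [← Finset.mul_sum, hB, ← Nat.card_eq_fintype_card (α := (P : Subgroup G))] at h2
  obtain ⟨e, he⟩ := card_dvd_of_le hOP
  have hodd : n % 2 = 1 := by
    have := card_sylow_modEq_one 2 G
    exact this
  have hOpos : 0 < Nat.card O := Nat.card_pos
  refine ⟨e, ?_, by rw [he, mul_comm]⟩
  set k := Fintype.card (Quotient (MulAction.orbitRel P (Sylow 2 G)))
  change 3 * (k * Nat.card (P : Subgroup G)) = Nat.card (P : Subgroup G) * n + _ at h2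
  rw [he] at h2
  have h3 : 3 * k * e = e * n + 2 * n := by
    apply Nat.eq_of_mul_eq_mul_left hOpos
    linarith
  have h4 : e ∣ 2 * n := by
    rw [← Nat.dvd_add_right (Dvd.intro n rfl : e ∣ e * n), ← h3]
    exact Dvd.intro_left _ rfl
  obtain ⟨j, hj⟩ := P.2.exists_card_eq
  have h5 : e ∣ 2 ^ j := by
    rw [← hj, he]; exact Dvd.intro_left _ rfl
  have h6 : e ∣ 2 := by
    refine Nat.Coprime.dvd_of_dvd_mul_right ?_ h4
    exact Nat.Coprime.coprime_dvd_left h5 (Nat.Coprime.pow_left _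
      ((Nat.coprime_two_left).2 (Nat.odd_iff.2 hodd)))
  have := (Nat.dvd_prime Nat.prime_two).1 h6
  exact this

end SizeBound

/-! ### Sylow `3`-subgroups -/

/-- If conjugation by the `3`-element `q` multiplies `x` by a `2`-element `d` commuting with `q`,
then the powers of `q` multiply `x` by the powers of `d`, so `d = 1`. -/
theorem mem_cent_of_conj_eq_mul {q d x : G} (hq : IsPElem 3 q) (hd : IsPElem 2 d)
    (hdq : d ∈ cent q) (hx : q * x * q⁻¹ = d * x) : x ∈ cent q := by
  have h1 : ∀ n : ℕ, q ^ n * x * (q ^ n)⁻¹ = d ^ n * x := by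
    intro n
    induction n with
    | zero => simp
    | succ n ih =>
      have h2 : d ^ n ∈ cent q := pow_mem hdq n
      calc q ^ (n + 1) * x * (q ^ (n + 1))⁻¹ = q * (q ^ n * x * (q ^ n)⁻¹) * q⁻¹ := by
            rw [pow_succ']; group
        _ = (q * d ^ n) * x * q⁻¹ := by rw [ih]; group
        _ = d ^ n * (q * x * q⁻¹) := by rw [← mem_cent.1 h2]; group
        _ = d ^ (n + 1) * x := by rw [hx, pow_succ]; group
  obtain ⟨k, hk⟩ := hq
  have h3 := h1 (3 ^ k)
  rw [hk] at h3
  simp only [one_mul, inv_one, mul_one, right_eq_mul] at h3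
  have h4 : d = 1 := hd.eq_one (by norm_num) ⟨k, h3⟩
  rw [h4, one_mul] at hx
  exact mem_cent_comm.1 (mem_cent_iff_conj.2 hx)

theorem exists_sylow_cent_of_mem [Finite G] {p : ℕ} [Fact p.Prime] (P : Sylow p G) {x q : G}
    (hq : IsPElem p q) (hqx : q ∈ cent x) :
    ∃ T ≤ cent x, q ∈ T ∧ IsPGroup p T ∧ Nat.card T * p ^ (cl x).factorization p = Nat.card P := by
  have hq' : IsPElem p (⟨q, hqx⟩ : cent x) := by
    obtain ⟨k, hk⟩ := hq
    exact ⟨k, Subtype.ext hk⟩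
  obtain ⟨S, hS⟩ := hq'.zpowers.exists_le_sylow
  refine ⟨(S : Subgroup (cent x)).map (cent x).subtype, map_subtype_le _,
    ⟨_, hS (mem_zpowers _), rfl⟩, S.2.map _, ?_⟩
  rw [card_map_of_injective (cent x).subtype_injective, ← card_sylow_eq_mul P x]
  congr 1
  exact S.card_eq_multiplicity

namespace SizeBound

variable {α δ : ℕ}

/-- If all `2`-elements had class size prime to `3`, every element would be conjugate into
`Q * C(Q)` for a Sylow `3`-subgroup `Q`. Then `G = Q * C(Q)`, so `Q` would be central, contradicting
the class size `3 * 2 ^ α`. -/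
theorem exists_two_elem_three_dvd [Finite G] (h : SizeBound G α δ) :
    ∃ y : G, IsPElem 2 y ∧ 3 ∣ cl y := by
  by_contra hcon
  push Not at hcon
  obtain ⟨Q⟩ : Nonempty (Sylow 3 G) := inferInstance
  set C := centralizer ((Q : Subgroup G) : Set G) with hC
  have htop : (Q : Subgroup G) ⊔ C = ⊤ := by
    apply eq_top_of_conj_cover
    intro g
    obtain ⟨x, q, z, hx, hq, hz, hxg, hqg, rfl⟩ := h.exists_decomp g
    have hqx : q ∈ cent x := (cent_le_of_mem_zpowers hxg) (mem_cent_comm.1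
      ((cent_le_of_mem_zpowers hqg) (mem_cent_self _)))
    obtain ⟨T, hT1, hqT, hT2, hT3⟩ := exists_sylow_cent_of_mem Q hq hqx
    rw [Nat.factorization_eq_zero_of_not_dvd (hcon x hx), pow_zero, mul_one] at hT3
    obtain ⟨k, hk⟩ := exists_conj_le_sylow_of_card Q hT2 hT3
    have hmap : (Q : Subgroup G).map (MulAut.conj k).toMonoidHom = T := by
      apply eq_of_le_of_card_ge
      · rintro _ ⟨t, ht, rfl⟩; exact hk t ht
      · rw [card_map_of_injective (MulAut.conj k).injective, hT3]
    have hq2 : k⁻¹ * q * k ∈ (Q : Subgroup G) := by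
      rw [← hmap] at hqT
      obtain ⟨t, ht, rfl⟩ := hqT
      have ht2 : t ∈ (Q : Subgroup G) := ht
      simpa [mul_assoc] using ht2
    have hx2 : k⁻¹ * x * k ∈ C := by
      refine mem_centralizer_iff.2 fun t ht => ?_
      have := conj_mem_cent k⁻¹ (hT1 (hk t ht))
      rw [mem_cent] at this
      simpa [mul_assoc] using this
    have hz2 : z ∈ C := center_le_centralizer _ hz
    refine ⟨k⁻¹, ?_⟩
    have : k⁻¹ * (x * q * z) * k⁻¹⁻¹ = (k⁻¹ * x * k) * (k⁻¹ * q * k) * z := by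
      rw [inv_inv, mul_assoc, mul_assoc _ z k, mem_cent.1 (center_le_cent k hz)]
      group
    rw [this]
    exact mul_mem (mul_mem (mem_sup_right hx2) (mem_sup_left hq2)) (mem_sup_right hz2)
  have hQ : (Q : Subgroup G) ≤ center G := by
    intro q hq
    apply h.mem_center_of_not_two_dvd
    have h1 := ncard_conj_mul (Q : Subgroup G) q
    have h2 : (fun h => h * q * h⁻¹) '' ((Q : Subgroup G) : Set G) = conjugatesOf q := by
      apply Set.Subset.antisymm
      · rintro _ ⟨g, -, rfl⟩; exact isConj_iff.2 ⟨g, rfl⟩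
      · intro y hy
        obtain ⟨g, rfl⟩ := isConj_iff.1 hy
        have hg : g ∈ (Q : Subgroup G) ⊔ C := htop ▸ mem_top g
        rw [← SetLike.mem_coe,
          coe_mul_of_right_le_normalizer_left _ _ (centralizer_le_normalizer _)] at hg
        obtain ⟨a, ha, b, hb, rfl⟩ := hg
        refine ⟨a, ha, ?_⟩
        have : q * b = b * q := mem_centralizer_iff.1 hb q hq
        simp only [mul_inv_rev]
        rw [mul_assoc a b q, ← this]; group
    rw [h2, ncard_conjugatesOf] at h1
    intro h2d
    obtain ⟨j, hj⟩ := Q.2.exists_card_eq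
    have h3 : 2 ∣ 3 ^ j := by
      rw [← hj, ← h1]; exact h2d.trans (Dvd.intro _ rfl)
    have := Nat.Prime.dvd_of_dvd_pow Nat.prime_two h3
    omega
  obtain ⟨x, hx⟩ := h.attained
  exact not_dvd_cl_of_sylow_le Q (hQ.trans (center_le_cent x)) (hx ▸ Dvd.intro _ rfl)

/-- A Sylow `2`-subgroup is generated by the `2`-core and one element of class size `3 * 2 ^ α`. -/
theorem exists_generator [Finite G] (h : SizeBound G α δ) (P : Sylow 2 G) :
    ∃ y ∈ P, cl y = 3 * 2 ^ α ∧ (P : Subgroup G) ≤ (P : Subgroup G).normalCore ⊔ zpowers y := by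
  obtain ⟨e, he, hc⟩ := h.card_sylow_eq P
  by_cases hPO : (P : Subgroup G) ≤ (P : Subgroup G).normalCore
  · obtain ⟨y, hy, h3⟩ := h.exists_two_elem_three_dvd
    obtain ⟨g, hg⟩ := hy.exists_conj_mem P
    exact ⟨_, hg, by rw [cl_conj]; exact h.eq_of_three_dvd h3, hPO.trans le_sup_left⟩
  · obtain ⟨y, hy, hyO⟩ := SetLike.not_le_iff_exists.1 hPO
    refine ⟨y, hy, h.cl_eq_of_not_mem_core P (P.2.isPElem hy) hyO, ?_⟩
    have hle : (P : Subgroup G).normalCore ⊔ zpowers y ≤ P :=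
      sup_le (normalCore_le _) (zpowers_le.2 hy)
    have hlt : (P : Subgroup G).normalCore < (P : Subgroup G).normalCore ⊔ zpowers y := by
      refine lt_of_le_of_ne le_sup_left fun heq => hyO ?_
      rw [heq]; exact mem_sup_right (mem_zpowers y)
    have h1 := Nat.le_of_dvd Nat.card_pos (two_mul_card_dvd (P.2.to_le hle) hlt)
    refine (eq_of_le_of_card_ge hle ?_).ge
    rw [hc]
    refine le_trans ?_ h1
    exact Nat.mul_le_mul_right _ (by omega)

/-- The `3`-elements commuting with a suitable `2`-element of class size `3 * 2 ^ α` are central: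
such an element centralizes the `2`-core (a form of Thompson's `A × B` lemma), hence a whole Sylow
`2`-subgroup. -/
theorem mem_center_of_mem_cent_generator [Finite G] (h : SizeBound G α δ) (P : Sylow 2 G) {y q : G}
    (hy : y ∈ P) (hcl : cl y = 3 * 2 ^ α)
    (hP : (P : Subgroup G) ≤ (P : Subgroup G).normalCore ⊔ zpowers y) (hq : IsPElem 3 q)
    (hqy : q ∈ cent y) : q ∈ center G := by
  have hyq := mem_cent_comm.1 hqy
  have hprod := cent_mul_of_isPElem (P.2.isPElem hy) hq hyq
  have hle : cent (y * q) ≤ cent y := hprod ▸ inf_le_left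
  have hd := cl_dvd_of_cent_le hle
  have h3 : cl (y * q) = 3 * 2 ^ α :=
    h.eq_of_three_dvd ((hcl ▸ Dvd.intro _ rfl : 3 ∣ cl y).trans hd)
  have hcq : cent y ≤ cent q := by
    rw [← cent_eq_of_le hle (by rw [h3, hcl]), hprod]; exact inf_le_right
  apply h.mem_center_of_sylow_le P
  set D := (cent q).subgroupOf (P : Subgroup G) with hD
  have hnil : Group.IsNilpotent P := P.2.isNilpotent
  by_contra hcon
  have hDlt : D < ⊤ := by
    rw [lt_top_iff_ne_top]
    intro heq
    exact hcon (subgroupOf_eq_top.1 heq)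
  have hlt := Group.normalizerCondition_of_isNilpotent D hDlt
  obtain ⟨x, hxN, hxD⟩ := SetLike.exists_of_lt hlt
  -- An element `x` normalizing `D = C_P(q)` is shown to commute with `q`.
  apply hxD
  rw [hD, mem_subgroupOf]
  have hyD : (⟨y, hy⟩ : (P : Subgroup G)) ∈ D := hyq
  have h4 : x⁻¹ * ⟨y, hy⟩ * x⁻¹⁻¹ ∈ D := (mem_normalizer_iff.1 (inv_mem hxN) _).1 hyD
  rw [hD, mem_subgroupOf] at h4
  simp only [coe_mul, coe_inv, inv_inv] at h4
  set x' : G := (x : G) with hx'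
  -- The commutator of `q` and `x'` lies in the `2`-core, because `q` centralizes `P` modulo it.
  have hdO : q * x' * q⁻¹ * x'⁻¹ ∈ (P : Subgroup G).normalCore := by
    have := hP x.2
    rw [← SetLike.mem_coe, normal_mul] at this
    obtain ⟨o, ho, w, ⟨j, rfl⟩, how⟩ := this
    simp only at how
    rw [hx', ← how]
    have hj : q * y ^ j = y ^ j * q := mem_cent.1 (mem_cent_comm.1 (zpow_mem hyq j))
    have : q * (o * y ^ j) * q⁻¹ * (o * y ^ j)⁻¹ = (q * o * q⁻¹) * o⁻¹ := by
      calc q * (o * y ^ j) * q⁻¹ * (o * y ^ j)⁻¹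
          = q * o * (y ^ j * q⁻¹ * (y ^ j)⁻¹) * o⁻¹ := by group
        _ = q * o * q⁻¹ * o⁻¹ := by
          have : y ^ j * q⁻¹ * (y ^ j)⁻¹ = q⁻¹ := by
            rw [mul_inv_eq_iff_eq_mul, eq_inv_mul_iff_mul_eq, ← mul_assoc, hj]; simp
          rw [this]
    rw [this]
    exact mul_mem ((normalCore_normal _).conj_mem _ ho q) (inv_mem ho)
  -- It commutes with `y`, because `q` commutes with `y` and with `x'⁻¹ * y * x'`.
  have hdy : q * x' * q⁻¹ * x'⁻¹ ∈ cent y := by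
    have e1 : q * (x'⁻¹ * y * x') * q⁻¹ = x'⁻¹ * y * x' :=
      mem_cent_iff_conj.1 (mem_cent_comm.1 h4)
    have e2 : q * y * q⁻¹ = y := mem_cent_iff_conj.1 hqy
    rw [mem_cent_iff_conj]
    calc q * x' * q⁻¹ * x'⁻¹ * y * (q * x' * q⁻¹ * x'⁻¹)⁻¹
        = q * x' * q⁻¹ * (x'⁻¹ * y * x') * q * x'⁻¹ * q⁻¹ := by group
      _ = q * x' * q⁻¹ * (q * (x'⁻¹ * y * x') * q⁻¹) * q * x'⁻¹ * q⁻¹ := by rw [e1]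
      _ = q * y * q⁻¹ := by group
      _ = y := e2
  exact mem_cent_of_conj_eq_mul (d := q * x' * q⁻¹ * x'⁻¹) hq
    (P.2.isPElem (normalCore_le _ hdO)) (hcq hdy) (by group)

end SizeBound

/-- The structure forced by `SizeBound`: the `2`-core has index `e ≤ 2` in the Sylow `2`-subgroup
`P`, modulo the centre a Sylow `3`-subgroup has order three, generated by `c`, and the index of `P`
modulo the centre divides three. -/
structure Frame {G : Type*} [Group G] (α δ e : ℕ) (P : Sylow 2 G) (c : G) : Prop
    extends SizeBound G α δ where
  e_eq : e = 1 ∨ e = 2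
  card_P : Nat.card P = e * Nat.card (P : Subgroup G).normalCore
  c_three : IsPElem 3 c
  c_not_mem : c ∉ center G
  c_cube : c ^ 3 ∈ center G
  sylow3 : ∃ Q : Sylow 3 G, c ∈ Q ∧ ∀ q ∈ Q, ∃ j : ℤ, ∃ z ∈ center G, q = c ^ j * z
  index_dvd : ((P : Subgroup G) ⊔ center G).index ∣ 3

theorem SizeBound.exists_frame [Finite G] {α δ : ℕ} (h : SizeBound G α δ) (P : Sylow 2 G) :
    ∃ e c, Frame α δ e P c := by
  obtain ⟨e, he, hc⟩ := h.card_sylow_eq P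
  obtain ⟨y, hy, hcl, hP⟩ := h.exists_generator P
  obtain ⟨Q⟩ : Nonempty (Sylow 3 G) := inferInstance
  obtain ⟨T, hT1, hT2, hT3⟩ := exists_sylow_cent Q y
  rw [hcl, factorization_three_three_mul, pow_one] at hT3
  have hTZ : T ≤ center G := fun t ht =>
    h.mem_center_of_mem_cent_generator P hy hcl hP (hT2.isPElem ht) (hT1 ht)
  have hTQ : T ≤ Q := fun t ht => mem_sylow_of_center Q (hTZ ht) (hT2.isPElem ht)
  have hQZ : ¬ (Q : Subgroup G) ≤ center G := fun hle =>
    not_dvd_cl_of_sylow_le Q (hle.trans (center_le_cent y)) (hcl ▸ Dvd.intro _ rfl)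
  obtain ⟨c, hcQ, hcZ⟩ := SetLike.not_le_iff_exists.1 hQZ
  have hTpos : 0 < Nat.card T := Nat.card_pos
  have hrel : T.relIndex Q = 3 := by
    have := relIndex_mul_relIndex ⊥ T Q bot_le hTQ
    rw [relIndex_bot_left, relIndex_bot_left] at this
    exact Nat.eq_of_mul_eq_mul_left hTpos (this.trans hT3.symm)
  have hTn : (T.subgroupOf Q).Normal := by
    refine ⟨fun n hn g => ?_⟩
    rw [mem_subgroupOf] at hn ⊢
    have := mem_cent_iff_conj.1 (mem_cent_of_center (hTZ hn) (g : G))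
    simpa [this] using hn
  have hgen : T ⊔ zpowers c = Q := by
    have hle : T ⊔ zpowers c ≤ Q := sup_le hTQ (zpowers_le.2 hcQ)
    apply eq_of_le_of_card_ge hle
    have h1 : Nat.card T ∣ Nat.card (T ⊔ zpowers c : Subgroup G) := card_dvd_of_le le_sup_left
    have h2 := card_dvd_of_le hle
    obtain ⟨r, hr⟩ := h1
    rw [← hT3, hr] at h2
    have h3 : r ∣ 3 := Nat.dvd_of_mul_dvd_mul_left hTpos h2
    rcases (Nat.dvd_prime Nat.prime_three).1 h3 with rfl | rfl
    · exfalso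
      have heq : T = T ⊔ zpowers c := eq_of_le_of_card_ge le_sup_left (by omega)
      apply hcZ
      apply hTZ
      rw [heq]; exact mem_sup_right (mem_zpowers c)
    · rw [hr, hT3]
  refine ⟨e, c, h, he, hc, Q.2.isPElem hcQ, hcZ, ?_, ⟨Q, hcQ, ?_⟩, ?_⟩
  · have := pow_index_mem (T.subgroupOf (Q : Subgroup G)) ⟨c, hcQ⟩
    change _ ^ T.relIndex Q ∈ _ at this
    rw [hrel, mem_subgroupOf] at this
    exact hTZ this
  · intro q hq
    have hq' : q ∈ T ⊔ zpowers c := hgen ▸ hq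
    have hn : T ≤ normalizer (zpowers c : Set G) := fun t ht =>
      centralizer_le_normalizer _ (center_le_centralizer _ (hTZ ht))
    rw [← SetLike.mem_coe, coe_mul_of_left_le_normalizer_right _ _ hn] at hq'
    obtain ⟨t, ht, _, ⟨j, rfl⟩, rfl⟩ := hq'
    exact ⟨j, t, hTZ ht, mem_cent.1 (center_le_cent _ (hTZ ht))⟩
  · rw [Nat.dvd_iff_prime_pow_dvd_dvd]
    intro p k hp hpk
    have : Fact p.Prime := ⟨hp⟩
    set H := (P : Subgroup G) ⊔ center G
    by_cases hk : k = 0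
    · simp [hk]
    have hpd : p ∣ H.index := (dvd_pow_self p hk).trans hpk
    by_cases hp3 : p = 3
    · subst hp3
      obtain ⟨s, hs⟩ := card_dvd_of_le (hTZ.trans (le_sup_right : center G ≤ H))
      have h1 : 3 ^ k * Nat.card T ∣ Nat.card G := by
        rw [← H.index_mul_card]
        exact mul_dvd_mul hpk ⟨s, hs⟩
      obtain ⟨j, hj⟩ := hT2.exists_card_eq
      have h2 : 3 ^ k * Nat.card T ∣ Nat.card Q := by
        rw [Q.card_eq_multiplicity]
        rw [hj, ← pow_add] at h1 ⊢
        exact pow_dvd_pow _ ((hp.pow_dvd_iff_le_factorization Nat.card_pos.ne').1 h1)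
      rw [← hT3, mul_comm] at h2
      exact Nat.dvd_of_mul_dvd_mul_left hTpos h2
    · exfalso
      by_cases hp2 : p = 2
      · subst hp2
        exact P.not_dvd_index (hpd.trans (index_dvd_of_le le_sup_left))
      · obtain ⟨S⟩ : Nonempty (Sylow p G) := inferInstance
        have hS : (S : Subgroup G) ≤ center G := by
          intro s hs
          obtain ⟨i, hi⟩ := S.2.isPElem hs
          exact h.mem_center_of_coprime hi
            (((Nat.coprime_primes Nat.prime_two hp).2 (Ne.symm hp2)).pow_right _)
            (((Nat.coprime_primes Nat.prime_three hp).2 (Ne.symm hp3)).pow_right _)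
        exact S.not_dvd_index (hpd.trans (index_dvd_of_le (hS.trans le_sup_right)))

/-! ### The centralizer of a noncentral `3`-element -/

/-- The `2`-core, as the normal core of a Sylow `2`-subgroup. -/
abbrev core (P : Sylow 2 G) : Subgroup G := (P : Subgroup G).normalCore

theorem core_isPGroup (P : Sylow 2 G) : IsPGroup 2 (core P) := P.2.to_le (normalCore_le _)

theorem exists_sylow_cent_of_le [Finite G] {p : ℕ} [Fact p.Prime] (P : Sylow p G) {x : G}
    {S : Subgroup G} (hS : IsPGroup p S) (hSx : S ≤ cent x) :
    ∃ T ≤ cent x, S ≤ T ∧ IsPGroup p T ∧ Nat.card T * p ^ (cl x).factorization p = Nat.card P := by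
  have hS' : IsPGroup p (S.subgroupOf (cent x)) :=
    hS.of_equiv (subgroupOfEquivOfLe hSx).symm
  obtain ⟨U, hU⟩ := hS'.exists_le_sylow
  refine ⟨(U : Subgroup (cent x)).map (cent x).subtype, map_subtype_le _,
    fun s hs => ⟨⟨s, hSx hs⟩, hU hs, rfl⟩, U.2.map _, ?_⟩
  rw [card_map_of_injective (cent x).subtype_injective, ← card_sylow_eq_mul P x]
  congr 1
  exact U.card_eq_multiplicity

theorem exists_four_pow {a b : ℕ} (h : 2 ^ b ≤ 2 ^ a) (hmod : 2 ^ a ≡ 2 ^ b [MOD 3]) :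
    ∃ j, 2 ^ a = 4 ^ j * 2 ^ b := by
  have hba : b ≤ a := (Nat.pow_le_pow_iff_right (by norm_num)).1 h
  obtain ⟨d, rfl⟩ := Nat.exists_eq_add_of_le hba
  obtain ⟨j, hj | hj⟩ := Nat.even_or_odd' d
  · refine ⟨j, ?_⟩
    rw [hj, pow_add, pow_mul]; norm_num [mul_comm]
  · exfalso
    rw [hj, pow_add, pow_add, pow_mul] at hmod
    have h1 : 2 ^ 2 ≡ 1 [MOD 3] := by decide
    have h2 := (h1.pow j)
    rw [one_pow] at h2
    have h3 : 2 ^ b * ((2 ^ 2) ^ j * 2 ^ 1) ≡ 2 ^ b * (1 * 2 ^ 1) [MOD 3] :=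
      (h2.mul_right _).mul_left _
    have h4 : 2 ^ b * (1 * 2 ^ 1) ≡ 2 ^ b * 1 [MOD 3] := by
      rw [mul_one]; exact h3.symm.trans hmod
    have h5 : 1 * 2 ^ 1 ≡ 1 [MOD 3] := Nat.ModEq.cancel_left_of_coprime (by
      rw [Nat.Coprime.gcd_eq_one]; exact Nat.Coprime.pow_right _ (by norm_num)) h4
    exact absurd h5 (by decide)

/-- A `3`-element acting on a `2`-group fixes a subgroup whose index is a power of four. -/
theorem exists_card_eq_four_pow [Finite G] {c : G} (hc : IsPElem 3 c) {X : Subgroup G}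
    (hX : IsPGroup 2 X) (hcX : ∀ x ∈ X, c * x * c⁻¹ ∈ X) :
    ∃ j, Nat.card X = 4 ^ j * Nat.card (X ⊓ cent c : Subgroup G) := by
  have h1 := ncard_modEq_fixed hc (X : Set G) hcX
  have h2 : ((X : Set G) ∩ cent c).ncard = Nat.card (X ⊓ cent c : Subgroup G) := by
    rw [← coe_inf, ← Nat.card_coe_set_eq]; rfl
  have h3 : (X : Set G).ncard = Nat.card X := by rw [← Nat.card_coe_set_eq]; rfl
  rw [h2, h3] at h1
  have hle : Nat.card (X ⊓ cent c : Subgroup G) ≤ Nat.card X :=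
    Nat.le_of_dvd Nat.card_pos (card_dvd_of_le inf_le_left)
  obtain ⟨a, ha⟩ := hX.exists_card_eq
  obtain ⟨b, hb⟩ := (hX.to_le (inf_le_left : X ⊓ cent c ≤ X)).exists_card_eq
  rw [ha, hb] at hle h1 ⊢
  exact exists_four_pow hle h1

/-- A coset of a `2`-group that is invariant under a `3`-element `c` contains an element commuting
with `c`. -/
theorem exists_mul_mem_cent [Finite G] {c : G} (hc : IsPElem 3 c) {N : Subgroup G}
    (hN : IsPGroup 2 N) (hcN : ∀ x ∈ N, c * x * c⁻¹ ∈ N) {u : G} (hu : u⁻¹ * (c * u * c⁻¹) ∈ N) :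
    ∃ n ∈ N, u * n ∈ cent c := by
  have h1 := ncard_modEq_fixed hc ((fun n => u * n) '' (N : Set G)) (by
    rintro _ ⟨n, hn, rfl⟩
    refine ⟨u⁻¹ * (c * u * c⁻¹) * (c * n * c⁻¹), mul_mem hu (hcN n hn), ?_⟩
    simp only
    group)
  rw [Set.ncard_image_of_injective _ (mul_right_injective u)] at h1
  have h3 : (N : Set G).ncard = Nat.card N := by rw [← Nat.card_coe_set_eq]; rfl
  obtain ⟨a, ha⟩ := hN.exists_card_eq
  rw [h3, ha] at h1
  have hne : ((fun n => u * n) '' (N : Set G) ∩ cent c).ncard ≠ 0 := by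
    intro h0
    rw [h0] at h1
    exact not_three_dvd_two_pow a ((Nat.modEq_zero_iff_dvd).1 h1)
  obtain ⟨_, ⟨n, hn, rfl⟩, hnc⟩ := (Set.ncard_pos).1 (Nat.pos_of_ne_zero hne)
  exact ⟨n, hn, hnc⟩

namespace Frame

variable {α δ e : ℕ} {P : Sylow 2 G} {c : G}

/-- An element commuting with `c` commutes with a Sylow `3`-subgroup. -/
theorem not_three_dvd [Finite G] (f : Frame α δ e P c) {g : G} (hg : g ∈ cent c) : ¬ 3 ∣ cl g := by
  obtain ⟨Q, hcQ, hQ⟩ := f.sylow3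
  refine not_dvd_cl_of_sylow_le Q fun q hq => ?_
  obtain ⟨j, z, hz, rfl⟩ := hQ q hq
  exact mul_mem (zpow_mem (mem_cent_comm.1 hg) j) (center_le_cent g hz)

theorem exists_conj_mem_cent [Finite G] (f : Frame α δ e P c) {g : G} (hg : ¬ 3 ∣ cl g) :
    ∃ h : G, h * g * h⁻¹ ∈ cent c := by
  obtain ⟨Q, hcQ, hQ⟩ := f.sylow3
  obtain ⟨h, hh⟩ := exists_conj_sylow_le_cent Q hg
  exact ⟨h, mem_cent_comm.1 (hh c hcQ)⟩

/-- By Wielandt's criterion the `2`-elements commuting with `c` lie in the `2`-core. -/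
theorem mem_core [Finite G] (f : Frame α δ e P c) {x : G} (hx : x ∈ cent c) (h2 : IsPElem 2 x) :
    x ∈ core P :=
  mem_normalCore_of_cl_eq P h2 (f.eq_two_pow (f.not_three_dvd hx))

theorem cube_zpow (f : Frame α δ e P c) (j : ℤ) : (c ^ 3) ^ j ∈ center G := zpow_mem f.c_cube j

theorem eq_of_three_elem [Finite G] (f : Frame α δ e P c) {q : G} (hq : q ∈ cent c)
    (h3 : IsPElem 3 q) : ∃ j : ℤ, ∃ z ∈ center G, q = c ^ j * z := by
  obtain ⟨Q, hcQ, hQ⟩ := f.sylow3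
  refine hQ q ((SizeBound.mem_sylow_iff_fixed Q h3).1 ?_)
  rw [Sylow.smul_eq_iff_mem_normalizer]
  refine centralizer_le_normalizer _ (mem_centralizer_iff.2 fun t ht => ?_)
  obtain ⟨j, z, hz, rfl⟩ := hQ t ht
  exact mem_cent.1 (mul_mem (zpow_mem (mem_cent_comm.1 hq) j) (center_le_cent q hz))

/-- The centralizer of `c` is generated by the fixed points of `c` in the `2`-core, `c` itself and
the centre. -/
theorem exists_eq [Finite G] (f : Frame α δ e P c) {g : G} (hg : g ∈ cent c) :
    ∃ r ∈ core P ⊓ cent c, ∃ j : ℤ, ∃ z ∈ center G, g = r * c ^ j * z := by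
  obtain ⟨x, q, z, hx, hq, hz, hxg, hqg, hgg⟩ := f.exists_decomp g
  have hxc : x ∈ cent c := (zpowers_le.2 hg) hxg
  obtain ⟨j, w, hw, rfl⟩ := f.eq_of_three_elem ((zpowers_le.2 hg) hqg) hq
  exact ⟨x, ⟨f.mem_core hxc hx, hxc⟩, j, w * z, mul_mem hw hz, by rw [hgg]; group⟩

theorem core_conj (P : Sylow 2 G) {x : G} (g : G) (hx : x ∈ core P) : g * x * g⁻¹ ∈ core P :=
  (normalCore_normal _).conj_mem _ hx g

/-- The class size of `c` is `2 ^ γ`, and `γ` is determined by the index of the fixed points of `c`.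
-/
theorem cl_c [Finite G] (f : Frame α δ e P c) :
    ∃ γ, α ≤ γ ∧ γ ≤ δ ∧ cl c = 2 ^ γ ∧
      e * Nat.card (core P) = 2 ^ γ * Nat.card (core P ⊓ cent c : Subgroup G) := by
  rcases f.eq_of_not_three_dvd (f.not_three_dvd (mem_cent_self c)) with h1 | ⟨γ, h1, h2, h3⟩
  · exact absurd (cl_eq_one_iff.1 h1) f.c_not_mem
  · refine ⟨γ, h1, h2, h3, ?_⟩
    have := card_mul_pPart_eq P (x := c) (T := core P ⊓ cent c) (core_isPGroup P).to_inf_left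
      inf_le_right (fun a ha h2 => ⟨f.mem_core ha h2, ha⟩)
    rw [h3, factorization_two_pow] at this
    rw [← f.card_P, ← this, mul_comm]

theorem cent_mul_c [Finite G] (f : Frame α δ e P c) {r : G} (hr : r ∈ core P ⊓ cent c) :
    cent (r * c) = cent r ⊓ cent c :=
  cent_mul_of_isPElem ((core_isPGroup P).isPElem hr.1) f.c_three hr.2

/-- The class size of `r * c`, for a fixed point `r` of `c`, is governed by the centralizer of `r`
among the fixed points of `c`. -/
theorem cl_mul_c [Finite G] (f : Frame α δ e P c) {r : G} (hr : r ∈ core P ⊓ cent c) :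
    ∃ k, α ≤ k ∧ k ≤ δ ∧ cl (r * c) = 2 ^ k ∧
      e * Nat.card (core P) = 2 ^ k * Nat.card (core P ⊓ cent c ⊓ cent r : Subgroup G) := by
  have hc := f.cent_mul_c hr
  have hmem : r * c ∈ cent c := mul_mem hr.2 (mem_cent_self c)
  have hnc : r * c ∉ center G := by
    intro h
    apply f.c_not_mem
    rw [← cl_eq_one_iff, cl, index_eq_one, eq_top_iff]
    intro g _
    have h2 : g ∈ cent (r * c) := mem_cent_of_center h g
    rw [hc] at h2
    exact h2.2
  rcases f.eq_of_not_three_dvd (f.not_three_dvd hmem) with h1 | ⟨k, h1, h2, h3⟩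
  · exact absurd (cl_eq_one_iff.1 h1) hnc
  · refine ⟨k, h1, h2, h3, ?_⟩
    have := card_mul_pPart_eq P (x := r * c) (T := core P ⊓ cent c ⊓ cent r)
      (core_isPGroup P).to_inf_left.to_inf_left (by
        rw [hc]; exact le_inf inf_le_right (inf_le_left.trans inf_le_right))
      (fun a ha h2 => by
        rw [hc] at ha
        exact ⟨⟨f.mem_core ha.2 h2, ha.2⟩, ha.1⟩)
    rw [h3, factorization_two_pow] at this
    rw [← f.card_P, ← this, mul_comm]

/-- Every class size prime to `3` is that of `r` or `r * c` for some fixed point `r` of `c` in the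
`2`-core. -/
theorem cl_cases [Finite G] (f : Frame α δ e P c) {g : G} (hg : ¬ 3 ∣ cl g) :
    ∃ r ∈ core P ⊓ cent c, cl g = cl r ∨ cl g = cl (r * c) := by
  obtain ⟨h, hh⟩ := f.exists_conj_mem_cent hg
  obtain ⟨r, hr, j, z, hz, heq⟩ := f.exists_eq hh
  refine ⟨r, hr, ?_⟩
  rw [← cl_conj h g, heq]
  -- Since `c ^ 3` is central, only `j` modulo three matters, and `c⁻¹` has the centralizer of `c`.
  have hj : c ^ j = c ^ (j % 3) * (c ^ 3) ^ (j / 3) := by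
    conv_lhs => rw [← Int.emod_add_mul_ediv j 3, zpow_add, zpow_mul]
    norm_cast
  rw [cl_mul_center _ hz, hj, ← mul_assoc, cl_mul_center _ (f.cube_zpow _)]
  have h0 := Int.emod_nonneg j (by norm_num : (3 : ℤ) ≠ 0)
  have h3 := Int.emod_lt_of_pos j (by norm_num : (0 : ℤ) < 3)
  obtain h | h | h : j % 3 = 0 ∨ j % 3 = 1 ∨ j % 3 = 2 := by omega
  · left; rw [h, zpow_zero, mul_one]
  · right; rw [h, zpow_one]
  · right
    have e1 : c ^ (2 : ℤ) = c⁻¹ * c ^ 3 := by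
      rw [eq_inv_mul_iff_mul_eq]; group
    have hinv : cent c⁻¹ = cent c := le_antisymm
      (cent_le_of_mem_zpowers ⟨-1, by simp⟩) (cent_le_of_mem_zpowers (inv_mem (mem_zpowers c)))
    rw [h, e1, ← mul_assoc, cl_mul_center _ f.c_cube, cl, cl, f.cent_mul_c hr,
      cent_mul_of_isPElem ((core_isPGroup P).isPElem hr.1) f.c_three.inv (by
        rw [hinv]; exact hr.2), hinv]

/-- Comparison of the `2`-part of a class size with the index of the centralizer in the
`2`-core. -/
theorem card_core_eq [Finite G] (f : Frame α δ e P c) (x : G) :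
    ∃ k, (k = 1 ∨ k = e) ∧ e * Nat.card (core P) =
      k * 2 ^ (cl x).factorization 2 * Nat.card (core P ⊓ cent x : Subgroup G) := by
  obtain ⟨T, hTx, hST, hT, hc⟩ := exists_sylow_cent_of_le P (x := x)
    (S := core P ⊓ cent x) (core_isPGroup P).to_inf_left inf_le_right
  have hinf : core P ⊓ T = core P ⊓ cent x :=
    le_antisymm (inf_le_inf_left _ hTx) (le_inf inf_le_left hST)
  have h1 : Nat.card (core P ⊓ T : Subgroup G) * (core P).relIndex T = Nat.card T := by
    have := relIndex_mul_relIndex ⊥ (core P ⊓ T) T bot_le inf_le_right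
    rwa [relIndex_bot_left, relIndex_bot_left, inf_relIndex_right] at this
  have h2 : Nat.card (core P) * (core P).relIndex T = Nat.card (T ⊔ core P : Subgroup G) := by
    have := relIndex_mul_relIndex ⊥ (core P) (T ⊔ core P) bot_le le_sup_right
    rwa [relIndex_bot_left, relIndex_bot_left, relIndex_sup_right] at this
  have h3 : IsPGroup 2 (T ⊔ core P : Subgroup G) := hT.to_sup_of_normal_right (core_isPGroup P)
  have h4 : Nat.card (T ⊔ core P : Subgroup G) ∣ Nat.card P := by
    obtain ⟨j, hj⟩ := h3.exists_card_eq
    rw [P.card_eq_multiplicity, hj]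
    exact pow_dvd_pow _ ((Nat.prime_two.pow_dvd_iff_le_factorization Nat.card_pos.ne').1
      (hj ▸ card_subgroup_dvd_card _))
  have h5 : (core P).relIndex T ∣ e := by
    rw [← h2, f.card_P, mul_comm e] at h4
    exact Nat.dvd_of_mul_dvd_mul_left Nat.card_pos h4
  refine ⟨(core P).relIndex T, ?_, ?_⟩
  · rcases f.e_eq with rfl | rfl
    · exact Or.inl (Nat.dvd_one.1 h5)
    · exact (Nat.dvd_prime Nat.prime_two).1 h5
  · rw [← f.card_P, ← hc, ← h1, hinf]; ring

theorem card_cent_outside [Finite G] (f : Frame α δ e P c) {t : G} (ht : t ∈ P)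
    (htO : t ∉ core P) :
    Nat.card ((P : Subgroup G) ⊓ cent t : Subgroup G) * 2 ^ α = Nat.card P :=
  (f.conj_outside_core P ht htO).2

end Frame

/-! ### Fixed points of `c` in the `2`-core -/

namespace Frame

variable {α δ e : ℕ} {P : Sylow 2 G} {c : G}

theorem core_cent_conj_mem {x : G} (hx : x ∈ cent c) {u : G} (hu : u ∈ core P ⊓ cent x) :
    c * u * c⁻¹ ∈ core P ⊓ cent x := by
  refine ⟨core_conj P c hu.1, ?_⟩
  have := conj_mem_cent c hu.2
  rwa [mem_cent_iff_conj.1 (mem_cent_comm.1 hx)] at this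

/-- The exponent `γ` of the class size of `c` is even or odd according to `e`, since the fixed
points of `c` have index a power of four. -/
theorem exists_parity [Finite G] (f : Frame α δ e P c) {γ : ℕ}
    (hγ : e * Nat.card (core P) = 2 ^ γ * Nat.card (core P ⊓ cent c : Subgroup G)) :
    ∃ m, Nat.card (core P) = 4 ^ m * Nat.card (core P ⊓ cent c : Subgroup G) ∧
      (e = 1 ∧ γ = 2 * m ∨ e = 2 ∧ γ = 2 * m + 1) := by
  obtain ⟨m, hm⟩ := exists_card_eq_four_pow f.c_three (core_isPGroup P)
    (fun x hx => core_conj P c hx)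
  refine ⟨m, hm, ?_⟩
  rw [hm, ← mul_assoc] at hγ
  have h1 : e * 4 ^ m = 2 ^ γ := Nat.eq_of_mul_eq_mul_right Nat.card_pos hγ
  have h4 : (4 : ℕ) ^ m = 2 ^ (2 * m) := by rw [pow_mul]; norm_num
  rcases f.e_eq with rfl | rfl
  · left
    refine ⟨rfl, ?_⟩
    rw [one_mul, h4] at h1
    exact (Nat.pow_right_injective le_rfl h1).symm
  · right
    refine ⟨rfl, ?_⟩
    rw [h4, ← pow_succ'] at h1
    exact (Nat.pow_right_injective le_rfl h1).symm

/-! ### The case where `c` centralizes the `2`-core -/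

theorem cl_c_eq_two [Finite G] (f : Frame α δ e P c) (h : core P ≤ cent c) :
    e = 2 ∧ α = 1 ∧ cl c = 2 := by
  obtain ⟨γ, h1, h2, h3, h4⟩ := f.cl_c
  rw [inf_eq_left.2 h] at h4
  have h5 : e = 2 ^ γ := Nat.eq_of_mul_eq_mul_right Nat.card_pos h4
  have hpos := f.pos
  have hγ : γ ≠ 0 := by omega
  obtain ⟨k, rfl⟩ := Nat.exists_eq_succ_of_ne_zero hγ
  rw [pow_succ] at h5 h3
  have hk : 0 < 2 ^ k := by positivity
  rcases f.e_eq with rfl | rfl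
  · omega
  · have hk1 : 2 ^ k = 1 := by omega
    have hk0 : k = 0 := by
      by_contra hk0
      have := Nat.one_lt_two_pow hk0
      omega
    subst hk0
    exact ⟨rfl, by omega, by rw [h3]; norm_num⟩

/-- If `c` centralizes the `2`-core, the centralizer of `c` has index two, hence is normal, and its
`3`-elements form the Sylow `3`-subgroup. -/
theorem sylow_three_normal [Finite G] (f : Frame α δ e P c) (h : core P ≤ cent c)
    (S : Sylow 3 G) : (S : Subgroup G).Normal := by
  have hn : (cent c).Normal := normal_of_index_eq_two (f.cl_c_eq_two h).2.2
  obtain ⟨Q, hcQ, hQ⟩ := f.sylow3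
  have hQn : (Q : Subgroup G).Normal := by
    refine ⟨fun q hq g => ?_⟩
    have hq3 : IsPElem 3 (g * q * g⁻¹) := (Q.2.isPElem hq).conj g
    have hqc : q ∈ cent c := by
      obtain ⟨j, z, hz, rfl⟩ := hQ q hq
      exact mul_mem (zpow_mem (mem_cent_self c) j) (center_le_cent c hz)
    obtain ⟨j, z, hz, heq⟩ := f.eq_of_three_elem (hn.conj_mem q hqc g) hq3
    have hcj : c ^ j ∈ Q := zpow_mem (show c ∈ (Q : Subgroup G) from hcQ) j
    have hz3 : IsPElem 3 z := by
      have h1 : z = (c ^ j)⁻¹ * (g * q * g⁻¹) := by rw [heq]; group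
      rw [h1]
      refine (Q.2.isPElem hcj).inv.mul hq3 (inv_mem ?_)
      rw [heq]
      exact mem_cent_comm.1 (mul_mem (mem_cent_self _) (center_le_cent _ hz))
    rw [heq]
    exact mul_mem hcj (mem_sylow_of_center Q hz hz3)
  obtain ⟨g, hg⟩ := MulAction.exists_smul_eq G Q S
  rwa [← hg, Sylow.smul_eq_of_normal]

/-- If `c` centralizes the `2`-core, no class has size eight. Otherwise some `r` in the `2`-core has
at least four conjugates under it, while every `p ∈ P` outside the `2`-core has centralizer of index
two in `P`. Comparing `C_P(p) ⊓ C_P(p⁻¹ * r)` with `C_P(r)` forces some element outside the `2`-core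
to centralize `P`. -/
theorem cl_ne_eight [Finite G] (f : Frame α δ e P c) (h : core P ≤ cent c) (g : G) :
    cl g ≠ 8 := by
  intro hg
  obtain ⟨he, hα, hc2⟩ := f.cl_c_eq_two h
  subst he hα
  obtain ⟨r, hr, hcl⟩ := f.cl_cases (g := g) (by rw [hg]; norm_num)
  have h4 : 4 * Nat.card (core P ⊓ cent r : Subgroup G) ≤ Nat.card (core P) := by
    rcases hcl with hcl | hcl
    · obtain ⟨k, hk, hkk⟩ := f.card_core_eq r
      rw [← hcl, hg, show (8 : ℕ) = 2 ^ 3 by norm_num, factorization_two_pow] at hkk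
      rcases hk with rfl | rfl <;> omega
    · obtain ⟨k, -, -, hk, hkk⟩ := f.cl_mul_c hr
      rw [← hk, ← hcl, hg, inf_eq_left.2 h] at hkk
      omega
  have hOP : core P ≤ P := normalCore_le _
  have hcP : Nat.card P = 2 * Nat.card (core P) := f.card_P
  have hcard : ∀ H : Subgroup G, H ≤ P → Nat.card H * H.relIndex P = Nat.card P := by
    intro H hH
    have := relIndex_mul_relIndex ⊥ H P bot_le hH
    rwa [relIndex_bot_left, relIndex_bot_left] at this
  have hOpos : 0 < Nat.card (core P) := Nat.card_pos
  have hrelO : (core P).relIndex P = 2 := by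
    have := hcard _ hOP
    rw [hcP, mul_comm] at this
    exact Nat.eq_of_mul_eq_mul_right hOpos this
  have hPr : Nat.card ((P : Subgroup G) ⊓ cent r : Subgroup G) ≤
      2 * Nat.card (core P ⊓ cent r : Subgroup G) := by
    have h1 := relIndex_mul_relIndex ⊥ (core P ⊓ (P ⊓ cent r)) (P ⊓ cent r) bot_le inf_le_right
    rw [relIndex_bot_left, relIndex_bot_left, inf_relIndex_right, ← inf_assoc,
      inf_eq_left.2 hOP] at h1
    have h2 : (core P).relIndex (P ⊓ cent r : Subgroup G) ≤ 2 := by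
      refine le_of_le_of_eq (relIndex_le_of_le_right inf_le_left ?_) hrelO
      rw [hrelO]; norm_num
    rw [← h1, mul_comm]
    exact Nat.mul_le_mul_right _ h2
  have hrO : r ∈ core P := hr.1
  -- Both `p` and `p⁻¹ * r` lie outside the `2`-core, so their centralizers have index two in `P`.
  have key : ∀ p ∈ P, p ∉ core P → Nat.card P ≤
      4 * Nat.card ((P ⊓ cent p) ⊓ (P ⊓ cent (p⁻¹ * r)) : Subgroup G) := by
    intro p hp hpO
    have hp' : p⁻¹ * r ∈ P := mul_mem (inv_mem hp) (hOP hrO)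
    have hpO' : p⁻¹ * r ∉ core P := fun hc => hpO (by
      have := mul_mem hrO (inv_mem hc)
      simpa using this)
    have e1 := f.card_cent_outside hp hpO
    have e2 := f.card_cent_outside hp' hpO'
    have hidx : ∀ H : Subgroup G, H ≤ P → Nat.card H * 2 ^ 1 = Nat.card P → H.relIndex P = 2 := by
      intro H hH h1
      rw [← hcard H hH] at h1
      exact (Nat.eq_of_mul_eq_mul_left Nat.card_pos h1).symm
    have h1 := relIndex_inf_le (H := (P : Subgroup G) ⊓ cent p)
      (K := (P : Subgroup G) ⊓ cent (p⁻¹ * r)) (L := P)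
    rw [hidx _ inf_le_left e1, hidx _ inf_le_left e2] at h1
    rw [← hcard _ ((inf_le_left.trans inf_le_left : (P : Subgroup G) ⊓ cent p ⊓
      ((P : Subgroup G) ⊓ cent (p⁻¹ * r)) ≤ P)), mul_comm]
    exact Nat.mul_le_mul_right _ h1
  have hsub : ∀ p, ((P : Subgroup G) ⊓ cent p) ⊓ (P ⊓ cent (p⁻¹ * r)) ≤
      (P : Subgroup G) ⊓ cent r := by
    rintro p s ⟨⟨hs, h1⟩, -, h2⟩
    refine ⟨hs, ?_⟩
    have := mul_mem (mem_cent_comm.1 h1) (mem_cent_comm.1 h2)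
    rw [mul_inv_cancel_left] at this
    exact mem_cent_comm.1 this
  have hlt : core P < P := lt_of_le_of_ne hOP fun heq => by
    have h1 : Nat.card (P : Subgroup G) = Nat.card (core P) := by rw [heq]
    omega
  obtain ⟨p0, hp0, hp0O⟩ := SetLike.exists_of_lt hlt
  have k0 := key p0 hp0 hp0O
  have c0 := Nat.le_of_dvd Nat.card_pos (card_dvd_of_le (hsub p0))
  have hlt2 : ¬ (P : Subgroup G) ⊓ cent r ≤ core P ⊓ cent r := fun hle => by
    have := Nat.le_of_dvd Nat.card_pos (card_dvd_of_le hle)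
    have hpos : 0 < Nat.card (core P ⊓ cent r : Subgroup G) := Nat.card_pos
    omega
  obtain ⟨s, hs, hsO⟩ := SetLike.not_le_iff_exists.1 hlt2
  have hsO : s ∉ core P := fun hc => hsO ⟨hc, hs.2⟩
  -- By the bounds on `C_P(r)` the intersection of the two centralizers is all of `C_P(r)`.
  have hscomm : ∀ p ∈ P, p ∉ core P → s ∈ cent p := by
    intro p hp hpO
    have k1 := key p hp hpO
    have heq := eq_of_le_of_card_ge (hsub p) (by omega)
    have : s ∈ ((P : Subgroup G) ⊓ cent p) ⊓ (P ⊓ cent (p⁻¹ * r)) := heq ▸ hs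
    exact this.1.2
  have hsP : (P : Subgroup G) ≤ cent s := by
    intro p hp
    rw [mem_cent_comm]
    by_cases hpO : p ∈ core P
    · have h1 : s⁻¹ * p ∉ core P := fun hc => hsO (by
        have := mul_mem hpO (inv_mem hc)
        simpa using this)
      have h2 := hscomm _ (mul_mem (inv_mem hs.1) hp) h1
      have := mul_mem (mem_cent_self s) (mem_cent_comm.1 h2)
      rw [mul_inv_cancel_left] at this
      exact mem_cent_comm.1 this
    · exact hscomm p hp hpO
  have := f.card_cent_outside hs.1 hsO
  rw [inf_eq_left.2 hsP] at this
  have hpos : 0 < Nat.card P := Nat.card_pos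
  change Nat.card P * 2 ^ 1 = Nat.card P at this
  omega

/-! ### Fixed points of index four -/

/-- If `c` has the largest possible class size `2 ^ δ` among powers of two, so do all `r * c`,
whence the fixed points of `c` in the `2`-core commute with each other. -/
theorem commute_of_cl_max [Finite G] (f : Frame α δ e P c)
    (hγ : e * Nat.card (core P) = 2 ^ δ * Nat.card (core P ⊓ cent c : Subgroup G)) {r : G}
    (hr : r ∈ core P ⊓ cent c) : core P ⊓ cent c ≤ cent r ∧ cl (r * c) = 2 ^ δ := by
  obtain ⟨k, -, hk, hcl, h1⟩ := f.cl_mul_c hr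
  rw [hγ] at h1
  have hle : Nat.card (core P ⊓ cent c ⊓ cent r : Subgroup G) ≤
    Nat.card (core P ⊓ cent c : Subgroup G) :=
      Nat.le_of_dvd Nat.card_pos (card_dvd_of_le inf_le_left)
  have hpos : 0 < Nat.card (core P ⊓ cent c : Subgroup G) := Nat.card_pos
  have hk2 : 2 ^ k ≤ 2 ^ δ := Nat.pow_le_pow_right (by norm_num) hk
  have hk0 : 0 < 2 ^ k := by positivity
  have heq : 2 ^ k = 2 ^ δ := by
    by_contra hne
    have : 2 ^ k < 2 ^ δ := lt_of_le_of_ne hk2 hne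
    nlinarith
  rw [heq] at h1
  have h2 := Nat.eq_of_mul_eq_mul_left (by positivity) h1
  exact ⟨inf_eq_left.1 (eq_of_le_of_card_ge inf_le_left h2.le), by rw [hcl, heq]⟩

/-- A `c`-invariant subgroup of the `2`-core properly containing the fixed points of `c` is at least
four times as large. -/
theorem four_mul_card_le [Finite G] (f : Frame α δ e P c) {X : Subgroup G} (hX : X ≤ core P)
    (hcX : ∀ x ∈ X, c * x * c⁻¹ ∈ X) (hR : core P ⊓ cent c ≤ X) {d : G} (hd : d ∈ X)
    (hdR : d ∉ core P ⊓ cent c) : 4 * Nat.card (core P ⊓ cent c : Subgroup G) ≤ Nat.card X := by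
  obtain ⟨j, hj⟩ := exists_card_eq_four_pow f.c_three ((core_isPGroup P).to_le hX) hcX
  have h1 : X ⊓ cent c = core P ⊓ cent c :=
    le_antisymm (inf_le_inf_right _ hX) (le_inf hR inf_le_right)
  rw [h1] at hj
  have hj0 : j ≠ 0 := by
    rintro rfl
    rw [pow_zero, one_mul] at hj
    exact hdR ((eq_of_le_of_card_ge hR hj.le) ▸ hd)
  rw [hj]
  exact Nat.mul_le_mul_right _ (Nat.le_self_pow hj0 4)

/-- If `R`, the group of fixed points of `c` in the `2`-core, is a proper subgroup of the `2`-core,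
it is a proper subgroup of its normalizer there. For `x` in this normalizer, outside `R`, the
commutator of `c` and `x` centralizes `R`, and it is outside `R` since otherwise `c` would commute
with `x`. -/
theorem exists_mem_core_centralizing [Finite G] (f : Frame α δ e P c) (h : ¬ core P ≤ cent c) :
    ∃ d ∈ core P, d ∉ cent c ∧ ∀ r ∈ core P ⊓ cent c, d ∈ cent r := by
  set D := (cent c).subgroupOf (core P) with hD
  have hnil : Group.IsNilpotent (core P) := (core_isPGroup P).isNilpotent
  have hDlt : D < ⊤ := by
    rw [lt_top_iff_ne_top]
    intro heq
    exact h (subgroupOf_eq_top.1 heq)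
  obtain ⟨x, hxN, hxD⟩ := SetLike.exists_of_lt (Group.normalizerCondition_of_isNilpotent D hDlt)
  set x' : G := (x : G) with hx'
  have hxO : x' ∈ core P := x.2
  have hdO : c * x' * c⁻¹ * x'⁻¹ ∈ core P := mul_mem (core_conj P c hxO) (inv_mem hxO)
  refine ⟨c * x' * c⁻¹ * x'⁻¹, hdO, fun hdc => hxD ?_, fun r hr => ?_⟩
  · exact mem_cent_of_conj_eq_mul (x := x') f.c_three ((core_isPGroup P).isPElem hdO) hdc (by group)
  · have hrD : (⟨r, hr.1⟩ : core P) ∈ D := hr.2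
    have h4 : x⁻¹ * ⟨r, hr.1⟩ * x⁻¹⁻¹ ∈ D := (mem_normalizer_iff.1 (inv_mem hxN) _).1 hrD
    rw [hD, mem_subgroupOf] at h4
    simp only [coe_mul, coe_inv, inv_inv] at h4
    have e1 : c * (x'⁻¹ * r * x') * c⁻¹ = x'⁻¹ * r * x' :=
      mem_cent_iff_conj.1 (mem_cent_comm.1 h4)
    have e2 : c * r * c⁻¹ = r := mem_cent_iff_conj.1 (mem_cent_comm.1 hr.2)
    rw [mem_cent_iff_conj]
    calc c * x' * c⁻¹ * x'⁻¹ * r * (c * x' * c⁻¹ * x'⁻¹)⁻¹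
        = c * x' * c⁻¹ * (x'⁻¹ * r * x') * c * x'⁻¹ * c⁻¹ := by group
      _ = c * x' * c⁻¹ * (c * (x'⁻¹ * r * x') * c⁻¹) * c * x'⁻¹ * c⁻¹ := by rw [e1]
      _ = c * r * c⁻¹ := by group
      _ = r := e2

/-- If `|P : O₂(G)| = 2` and `c` fixes a subgroup of index four in `O₂(G)`, then `α < 3`. -/
theorem alpha_lt_three [Finite G] (f : Frame α δ 2 P c)
    (h4 : Nat.card (core P) = 4 * Nat.card (core P ⊓ cent c : Subgroup G)) : α < 3 := by
  by_contra hα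
  have hpos : 0 < Nat.card (core P ⊓ cent c : Subgroup G) := Nat.card_pos
  obtain ⟨d, hdO, hdc, hd⟩ := f.exists_mem_core_centralizing (fun hle => by
    rw [inf_eq_left.2 hle] at h4 hpos; omega)
  have hlt : core P ⊓ cent c < core P ⊓ cent d :=
    lt_of_le_of_ne (le_inf inf_le_left fun r hr => mem_cent_comm.1 (hd r hr))
      (fun heq => hdc ((heq ▸ (⟨hdO, mem_cent_self d⟩ : d ∈ core P ⊓ cent d) :
        d ∈ core P ⊓ cent c)).2)
  have h1 := Nat.le_of_dvd Nat.card_pos (two_mul_card_dvd (core_isPGroup P).to_inf_left hlt)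
  obtain ⟨k, hk, hkk⟩ := f.card_core_eq d
  rcases f.factorization_eq_zero_or d with h2 | h2
  · exact hdc (center_le_cent c h2)
  · have h3 : 2 ^ 3 ≤ 2 ^ (cl d).factorization 2 := Nat.pow_le_pow_right (by norm_num) (by omega)
    have hk1 : 1 ≤ k := by rcases hk with rfl | rfl <;> norm_num
    have h5 : 1 * 2 ^ 3 * (2 * Nat.card (core P ⊓ cent c : Subgroup G)) ≤
        2 * Nat.card (core P) := by
      rw [hkk]
      exact Nat.mul_le_mul (Nat.mul_le_mul hk1 h3) h1
    omega

/-- If `|P : O₂(G)| = 2`, the fixed points of `c` have index four in `O₂(G)` and eight bounds the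
class sizes that are powers of two, then no class has size four. Here `c` has class size eight, and
a fixed point `r` of `c` commutes with all fixed points and with an element that is not fixed, hence
with all of `O₂(G)`. -/
theorem cl_ne_four [Finite G] (f : Frame α 3 2 P c)
    (h4 : Nat.card (core P) = 4 * Nat.card (core P ⊓ cent c : Subgroup G)) (g : G) :
    cl g ≠ 4 := by
  intro hg
  have hγ : 2 * Nat.card (core P) = 2 ^ 3 * Nat.card (core P ⊓ cent c : Subgroup G) := by omega
  have hpos : 0 < Nat.card (core P ⊓ cent c : Subgroup G) := Nat.card_pos
  obtain ⟨d, hdO, hdc, hd⟩ := f.exists_mem_core_centralizing (fun hle => by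
    rw [inf_eq_left.2 hle] at h4 hpos; omega)
  obtain ⟨r, hr, hcl⟩ := f.cl_cases (g := g) (by rw [hg]; norm_num)
  obtain ⟨hRr, hcl2⟩ := f.commute_of_cl_max hγ hr
  rcases hcl with hcl | hcl
  · have hle := f.four_mul_card_le (X := core P ⊓ cent r) inf_le_left
      (fun x hx => core_cent_conj_mem hr.2 hx) (le_inf inf_le_left hRr) ⟨hdO, hd r hr⟩
      (fun hc => hdc hc.2)
    obtain ⟨k, hk, hkk⟩ := f.card_core_eq r
    rw [← hcl, hg, show (4 : ℕ) = 2 ^ 2 by norm_num, factorization_two_pow] at hkk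
    rcases hk with rfl | rfl <;> omega
  · omega

end Frame

/-! ### Elements of the `2`-core that are central modulo the centre -/

/-- Elements of the `2`-core whose commutators with the `2`-core are central in `G`. -/
def secondCenter (P : Sylow 2 G) : Set G :=
  {w | w ∈ core P ∧ ∀ u ∈ core P, w * u * w⁻¹ * u⁻¹ ∈ center G}

theorem secondCenter_conj {P : Sylow 2 G} {w : G} (hw : w ∈ secondCenter P) (g : G) :
    g * w * g⁻¹ ∈ secondCenter P := by
  refine ⟨Frame.core_conj P g hw.1, fun u hu => ?_⟩
  have h1 := hw.2 _ (Frame.core_conj P g⁻¹ hu)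
  have h2 := mem_cent_iff_conj.1 (mem_cent_of_center h1 g)
  have h3 : g * w * g⁻¹ * u * (g * w * g⁻¹)⁻¹ * u⁻¹ =
      g * (w * (g⁻¹ * u * g⁻¹⁻¹) * w⁻¹ * (g⁻¹ * u * g⁻¹⁻¹)⁻¹) * g⁻¹ := by group
  rw [h3, h2]
  exact h1

/-- The centralizer in the `2`-core of `secondCenter P`. -/
def secondCentralizer (P : Sylow 2 G) : Subgroup G := core P ⊓ centralizer (secondCenter P)

theorem mem_secondCentralizer {P : Sylow 2 G} {x : G} :
    x ∈ secondCentralizer P ↔ x ∈ core P ∧ ∀ w ∈ secondCenter P, x ∈ cent w := by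
  rw [secondCentralizer, mem_inf, mem_centralizer_iff]
  refine and_congr_right fun _ => forall₂_congr fun w _ => ?_
  rw [mem_cent, eq_comm]

theorem secondCentralizer_conj {P : Sylow 2 G} {x : G} (hx : x ∈ secondCentralizer P) (g : G) :
    g * x * g⁻¹ ∈ secondCentralizer P := by
  rw [mem_secondCentralizer] at *
  refine ⟨Frame.core_conj P g hx.1, fun w hw => ?_⟩
  have h1 := conj_mem_cent g (hx.2 _ (secondCenter_conj hw g⁻¹))
  simpa [mul_assoc] using h1

namespace Frame

variable {α δ e : ℕ} {P : Sylow 2 G} {c : G}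

/-- The centre of the `2`-core is central in `G`. -/
theorem mem_center_of_core_le [Finite G] (f : Frame α δ e P c) (hα : e = 1 ∨ 2 ≤ α) {x : G}
    (hx : core P ≤ cent x) : x ∈ center G := by
  rcases f.factorization_eq_zero_or x with h | h
  · exact h
  · exfalso
    obtain ⟨k, hk, hkk⟩ := f.card_core_eq x
    rw [inf_eq_left.2 hx] at hkk
    have h1 : e = k * 2 ^ (cl x).factorization 2 := Nat.eq_of_mul_eq_mul_right Nat.card_pos hkk
    have hpos := f.pos
    have h2 : 2 ^ α ≤ 2 ^ (cl x).factorization 2 := Nat.pow_le_pow_right (by norm_num) h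
    have hk1 : 1 ≤ k := by rcases hk with rfl | rfl <;> rcases f.e_eq with h | h <;> omega
    have h3 : 2 ^ α ≤ e := by rw [h1]; nlinarith
    rcases hα with rfl | hα
    · have := Nat.one_lt_two_pow (show α ≠ 0 by omega)
      omega
    · have : 2 ^ 2 ≤ 2 ^ α := Nat.pow_le_pow_right (by norm_num) hα
      rcases f.e_eq with h | h <;> omega

/-- A subgroup normalized by the `2`-core, inside it and not contained in the centre of `G`,
contains an element of `secondCenter P` outside the centre. -/
theorem exists_mem_secondCenter [Finite G] (f : Frame α δ e P c) (hα : e = 1 ∨ 2 ≤ α)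
    {N : Subgroup G} (hNO : N ≤ core P) (hN : ∀ u ∈ core P, ∀ n ∈ N, u * n * u⁻¹ ∈ N)
    (hNZ : ¬ N ≤ center G) : ∃ w ∈ N, w ∉ center G ∧ w ∈ secondCenter P := by
  have hcen : ∀ x : core P, x ∈ center (core P) ↔ (x : G) ∈ center G := by
    intro x
    constructor
    · intro hx
      apply f.mem_center_of_core_le hα
      intro u hu
      have := Subgroup.mem_center_iff.1 hx ⟨u, hu⟩
      exact mem_cent.2 (congrArg Subtype.val this)
    · intro hx
      rw [Subgroup.mem_center_iff]
      intro g
      exact Subtype.ext (Subgroup.mem_center_iff.1 hx g)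
  have : (N.subgroupOf (core P)).Normal := ⟨fun n hn u => hN u u.2 n hn⟩
  obtain ⟨w, hw, hwc, hwu⟩ := exists_secondCenter (core_isPGroup P) (N.subgroupOf (core P))
    (fun hle => hNZ fun n hn => (hcen ⟨n, hNO hn⟩).1 (hle hn))
  exact ⟨w, hw, fun h => hwc ((hcen w).2 h), w.2, fun u hu => (hcen _).1 (hwu ⟨u, hu⟩)⟩

/-- If `w` is central modulo the centre and commutes with `c`, its conjugates under the `2`-core
are already its conjugates under the fixed points of `c`. -/
theorem card_mul_card_of_secondCenter [Finite G] (f : Frame α δ e P c) {w : G}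
    (hw : w ∈ secondCenter P) (hwc : w ∈ cent c) :
    Nat.card (core P) * Nat.card (core P ⊓ cent c ⊓ cent w : Subgroup G) =
      Nat.card (core P ⊓ cent c : Subgroup G) * Nat.card (core P ⊓ cent w : Subgroup G) := by
  have himg : (fun h => h * w * h⁻¹) '' (core P : Set G) =
      (fun h => h * w * h⁻¹) '' ((core P ⊓ cent c : Subgroup G) : Set G) := by
    apply Set.Subset.antisymm
    · rintro _ ⟨u, hu, rfl⟩
      have hcw : c * w * c⁻¹ = w := mem_cent_iff_conj.1 (mem_cent_comm.1 hwc)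
      -- The coset of `C(w)` containing `u` is `c`-invariant, so `u` may be replaced by a fixed
      -- point.
      obtain ⟨n, hn, hnc⟩ := exists_mul_mem_cent (u := u) f.c_three (N := core P ⊓ cent w)
        (core_isPGroup P).to_inf_left (fun x hx => core_cent_conj_mem hwc hx) (by
          refine mem_inf.2 ⟨mul_mem (inv_mem hu) (core_conj P c hu), ?_⟩
          have h1 := hw.2 u hu
          have h2 := mem_cent_iff_conj.1 (mem_cent_of_center h1 c)
          have h3 : c * u * c⁻¹ * w * (c * u * c⁻¹)⁻¹ = u * w * u⁻¹ := by
            have e1 : (c * (w * u * w⁻¹ * u⁻¹) * c⁻¹)⁻¹ * (c * w * c⁻¹) =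
              c * u * c⁻¹ * (c * w * c⁻¹) * (c * u * c⁻¹)⁻¹ := by group
            rw [h2, hcw] at e1
            rw [← e1]; group
          rw [mem_cent_iff_conj]
          calc u⁻¹ * (c * u * c⁻¹) * w * (u⁻¹ * (c * u * c⁻¹))⁻¹
              = u⁻¹ * (c * u * c⁻¹ * w * (c * u * c⁻¹)⁻¹) * u := by group
            _ = w := by rw [h3]; group)
      refine ⟨u * n, ⟨mul_mem hu hn.1, hnc⟩, ?_⟩
      have h4 := mem_cent_iff_conj.1 hn.2
      calc u * n * w * (u * n)⁻¹ = u * (n * w * n⁻¹) * u⁻¹ := by group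
        _ = u * w * u⁻¹ := by rw [h4]
    · exact Set.image_mono inf_le_left
  have h1 := ncard_conj_mul (core P) w
  have h2 := ncard_conj_mul (core P ⊓ cent c) w
  rw [himg] at h1
  rw [← h1, ← h2]; ring

/-- A fixed point of `c` in `secondCenter P` is central, unless `γ + α` is small compared with `δ`.
-/
theorem mem_center_or_le [Finite G] (f : Frame α δ e P c) {γ : ℕ}
    (hγ : e * Nat.card (core P) = 2 ^ γ * Nat.card (core P ⊓ cent c : Subgroup G)) {w : G}
    (hw : w ∈ secondCenter P) (hwc : w ∈ cent c) : w ∈ center G ∨ 2 ^ (γ + α) ≤ e * 2 ^ δ := by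
  rcases f.factorization_eq_zero_or w with h | h
  · exact Or.inl h
  right
  obtain ⟨κ, -, hκ, -, h1⟩ := f.cl_mul_c ⟨hw.1, hwc⟩
  obtain ⟨k, hk, h2⟩ := f.card_core_eq w
  have h3 := f.card_mul_card_of_secondCenter hw hwc
  set o := Nat.card (core P)
  set ρ := Nat.card (core P ⊓ cent c : Subgroup G)
  set ρw := Nat.card (core P ⊓ cent c ⊓ cent w : Subgroup G)
  set ow := Nat.card (core P ⊓ cent w : Subgroup G)
  set v := (cl w).factorization 2
  have hρ : 0 < ρ := Nat.card_pos
  have hρw : 0 < ρw := Nat.card_pos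
  have ho : 0 < o := Nat.card_pos
  have hk1 : 1 ≤ k := by rcases hk with rfl | rfl <;> rcases f.e_eq with h | h <;> omega
  have h4 : e * ρ = k * 2 ^ v * ρw := by
    apply Nat.eq_of_mul_eq_mul_left ho
    calc o * (e * ρ) = (e * o) * ρ := by ring
      _ = k * 2 ^ v * (ρ * ow) := by rw [h2]; ring
      _ = o * (k * 2 ^ v * ρw) := by rw [← h3]; ring
  have h5 : e * 2 ^ κ = k * 2 ^ v * 2 ^ γ := by
    apply Nat.eq_of_mul_eq_mul_right hρw
    calc e * 2 ^ κ * ρw = e * (2 ^ γ * ρ) := by rw [← hγ, h1]; ring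
      _ = (e * ρ) * 2 ^ γ := by ring
      _ = k * 2 ^ v * 2 ^ γ * ρw := by rw [h4]; ring
  calc 2 ^ (γ + α) = 1 * 2 ^ α * 2 ^ γ := by rw [pow_add]; ring
    _ ≤ k * 2 ^ v * 2 ^ γ := Nat.mul_le_mul_right _ (Nat.mul_le_mul hk1
        (Nat.pow_le_pow_right (by norm_num) h))
    _ = e * 2 ^ κ := h5.symm
    _ ≤ e * 2 ^ δ := Nat.mul_le_mul_left _ (Nat.pow_le_pow_right (by norm_num) hκ)

/-- The norm `w * w ^ c * w ^ (c * c)` of an element central modulo the centre is central, hence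
`w` commutes with the fixed points of `c`. -/
theorem commute_of_secondCenter [Finite G] (f : Frame α δ e P c)
    (hW : ∀ w ∈ secondCenter P, w ∈ cent c → w ∈ center G) {w : G} (hw : w ∈ secondCenter P) {r : G}
    (hr : r ∈ core P ⊓ cent c) : w ∈ cent r := by
  set w1 := c * w * c⁻¹ with hw1
  set w2 := c * w1 * c⁻¹ with hw2
  have hS1 : w1 ∈ secondCenter P := secondCenter_conj hw c
  have hS2 : w2 ∈ secondCenter P := secondCenter_conj hS1 c
  have hw3 : c * w2 * c⁻¹ = w := by
    have h1 := mem_cent_iff_conj.1 (center_le_cent w f.c_cube)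
    calc c * w2 * c⁻¹ = c ^ 3 * w * (c ^ 3)⁻¹ := by
          rw [hw2, hw1, pow_succ, pow_two]; group
      _ = w := h1
  have hmul : ∀ a ∈ secondCenter P, ∀ b ∈ secondCenter P, a * b ∈ secondCenter P := by
    intro a ha b hb
    refine ⟨mul_mem ha.1 hb.1, fun u hu => ?_⟩
    have h1 := hb.2 u hu
    have h2 := mem_cent_iff_conj.1 (mem_cent_of_center h1 a)
    have h3 : a * b * u * (a * b)⁻¹ * u⁻¹ =
        (a * (b * u * b⁻¹ * u⁻¹) * a⁻¹) * (a * u * a⁻¹ * u⁻¹) := by group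
    rw [h3, h2]
    exact mul_mem h1 (ha.2 u hu)
  have hcenS : ∀ z ∈ center G, z ∈ core P → z ∈ secondCenter P := by
    intro z hz hzO
    refine ⟨hzO, fun u _ => ?_⟩
    have : z * u * z⁻¹ * u⁻¹ = 1 := by
      rw [mem_cent_iff_conj.1 (center_le_cent u hz), mul_inv_cancel]
    rw [this]; exact one_mem _
  set n := w * w1 * w2 with hn
  have hnS : n ∈ secondCenter P := hmul _ (hmul _ hw _ hS1) _ hS2
  -- The norm `n` is fixed by `c` modulo the centre, hence it is central.
  have hcn : n⁻¹ * (c * n * c⁻¹) ∈ core P ⊓ center G := by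
    have h1 : c * n * c⁻¹ = w1 * w2 * w := by
      calc c * n * c⁻¹ = (c * w * c⁻¹) * (c * w1 * c⁻¹) * (c * w2 * c⁻¹) := by rw [hn]; group
        _ = w1 * w2 * w := by rw [hw3]
    refine mem_inf.2 ⟨mul_mem (inv_mem hnS.1) (core_conj P c hnS.1), ?_⟩
    rw [h1]
    have h2 := inv_mem (hw.2 _ (mul_mem hS1.1 hS2.1))
    have h3 := mem_cent_iff_conj.1 (mem_cent_of_center h2 (w * w1 * w2)⁻¹)
    have h4 : n⁻¹ * (w1 * w2 * w) =
        (w * w1 * w2)⁻¹ * (w * (w1 * w2) * w⁻¹ * (w1 * w2)⁻¹)⁻¹ * (w * w1 * w2)⁻¹⁻¹ := by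
      rw [hn]; group
    rw [h4, h3]
    exact h2
  obtain ⟨z, hz, hnz⟩ := exists_mul_mem_cent f.c_three (N := core P ⊓ center G)
    (core_isPGroup P).to_inf_left (fun x hx => by
      rwa [mem_cent_iff_conj.1 (mem_cent_of_center hx.2 c)]) hcn
  have hnz' := hW _ (hmul _ hnS _ (hcenS z hz.2 hz.1)) hnz
  have hnZ : n ∈ center G := by
    have := mul_mem hnz' (inv_mem hz.2)
    rwa [mul_inv_cancel_right] at this
  -- Conjugation by each of `w`, `w1`, `w2` multiplies `r` by the same central element `k`.
  set k := w * r * w⁻¹ * r⁻¹ with hk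
  have hkZ : k ∈ center G := hw.2 r hr.1
  have hkO : k ∈ core P := mul_mem (core_conj P w hr.1) (inv_mem hr.1)
  have hcr : c * r * c⁻¹ = r := mem_cent_iff_conj.1 (mem_cent_comm.1 hr.2)
  have hck : c * k * c⁻¹ = k := mem_cent_iff_conj.1 (mem_cent_of_center hkZ c)
  have a0 : w * r * w⁻¹ = k * r := by rw [hk]; group
  have step : ∀ a, a * r * a⁻¹ = k * r → (c * a * c⁻¹) * r * (c * a * c⁻¹)⁻¹ = k * r := by
    intro a ha
    calc (c * a * c⁻¹) * r * (c * a * c⁻¹)⁻¹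
        = (c * a * c⁻¹) * (c * r * c⁻¹) * (c * a * c⁻¹)⁻¹ := by rw [hcr]
      _ = c * (a * r * a⁻¹) * c⁻¹ := by group
      _ = (c * k * c⁻¹) * (c * r * c⁻¹) := by rw [ha]; group
      _ = k * r := by rw [hck, hcr]
  have a1 := step w a0
  have a2 := step _ a1
  have push : ∀ a, a * (k * r) * a⁻¹ = k * (a * r * a⁻¹) := by
    intro a
    have := mem_cent_iff_conj.1 (mem_cent_of_center hkZ a)
    calc a * (k * r) * a⁻¹ = (a * k * a⁻¹) * (a * r * a⁻¹) := by group
      _ = _ := by rw [this]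
  have hnr : n * r * n⁻¹ = k ^ 3 * r := by
    calc n * r * n⁻¹ = w * (w1 * (w2 * r * w2⁻¹) * w1⁻¹) * w⁻¹ := by rw [hn]; group
      _ = w * (k * (k * r)) * w⁻¹ := by rw [a2, push, a1]
      _ = k ^ 3 * r := by
        have e1 : w * (k * (k * r)) * w⁻¹ = (w * k * w⁻¹) * (w * (k * r) * w⁻¹) := by group
        rw [e1, push, a0, mem_cent_iff_conj.1 (mem_cent_of_center hkZ w), pow_succ, pow_two]
        group
  rw [mem_cent_iff_conj.1 (center_le_cent r hnZ)] at hnr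
  have hk3 : k ^ 3 = 1 := by simpa using hnr
  have hk1 : k = 1 :=
    ((core_isPGroup P).isPElem hkO).eq_one (by norm_num) (q := 3) ⟨1, by simpa using hk3⟩
  rw [hk1, one_mul] at a0
  exact mem_cent_iff_conj.2 a0

/-- If `secondCenter P` meets the fixed points of `c` centrally, its noncentral elements have class
size `3 * 2 ^ α`. -/
theorem cl_eq_of_secondCenter [Finite G] (f : Frame α δ e P c)
    (hW : ∀ w ∈ secondCenter P, w ∈ cent c → w ∈ center G) {w : G} (hw : w ∈ secondCenter P)
    (hwZ : w ∉ center G) : cl w = 3 * 2 ^ α := by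
  by_cases h3 : 3 ∣ cl w
  · exact f.eq_of_three_dvd h3
  · exfalso
    obtain ⟨g, hg⟩ := f.exists_conj_mem_cent h3
    have h1 := hW _ (secondCenter_conj hw g) hg
    apply hwZ
    have := (inferInstance : (center G).Normal).conj_mem _ h1 g⁻¹
    simpa [mul_assoc] using this

/-- If the fixed points of `c` in the `2`-core are central, all class sizes that are powers of two
are `1` or the class size of `c`. -/
theorem cl_eq_of_fixed_central [Finite G] (f : Frame α δ e P c)
    (hR : core P ⊓ cent c ≤ center G) {g : G} (hg : ¬ 3 ∣ cl g) : cl g = 1 ∨ cl g = cl c := by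
  obtain ⟨r, hr, h | h⟩ := f.cl_cases hg
  · left; rw [h, cl_eq_one_iff]; exact hR hr
  · right; rw [h, mem_cent.1 (center_le_cent c (hR hr)), cl_mul_center c (hR hr)]

end Frame

/-! ### The centralizer of `secondCenter P` -/

namespace Frame

variable {α δ e : ℕ} {P : Sylow 2 G} {c : G}

theorem fixed_le_secondCentralizer [Finite G] (f : Frame α δ e P c)
    (hW : ∀ w ∈ secondCenter P, w ∈ cent c → w ∈ center G) :
    core P ⊓ cent c ≤ secondCentralizer P := fun _ hr =>
  mem_secondCentralizer.2 ⟨hr.1, fun _ hw => mem_cent_comm.1 (f.commute_of_secondCenter hW hw hr)⟩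

/-- If `secondCenter P` meets the fixed points of `c` centrally, the class size of `c` is
`2 ^ (α + 2)`, and the centralizer of `secondCenter P` in the `2`-core coincides with the
centralizer there of each of its noncentral elements, and contains the fixed points of `c` with
index four. The noncentral elements of `secondCenter P` have class size `3 * 2 ^ α` and their
centralizers in the `2`-core contain the fixed points of `c` properly; a centralizer of
`secondCenter P` no larger than the group of fixed points would make the latter central, so that
`2 ^ α` could not be a class size. -/
theorem secondCentralizer_eq [Finite G] (f : Frame α δ e P c) (hα : e = 1 ∨ 2 ≤ α)
    (hδ : δ ≤ α + 2) (hcO : ¬ core P ≤ cent c)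
    (hW : ∀ w ∈ secondCenter P, w ∈ cent c → w ∈ center G) (hatt : ∃ g : G, cl g = 2 ^ α) :
    e * Nat.card (core P) = 2 ^ (α + 2) * Nat.card (core P ⊓ cent c : Subgroup G) ∧ δ = α + 2 ∧
    Nat.card (secondCentralizer P) = 4 * Nat.card (core P ⊓ cent c : Subgroup G) ∧
    ∀ w ∈ secondCenter P, w ∉ center G → core P ⊓ cent w = secondCentralizer P := by
  obtain ⟨γ, hγ1, hγ2, hγ3, hγ⟩ := f.cl_c
  set ρ := Nat.card (core P ⊓ cent c : Subgroup G) with hρ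
  have hρpos : 0 < ρ := Nat.card_pos
  have hRF := f.fixed_le_secondCentralizer hW
  have hFO : secondCentralizer P ≤ core P := inf_le_left
  have hFw : ∀ w ∈ secondCenter P, secondCentralizer P ≤ core P ⊓ cent w := fun w hw x hx =>
    ⟨hx.1, (mem_secondCentralizer.1 hx).2 w hw⟩
  have hpp : ∀ n, 0 < 2 ^ n := fun n => by positivity
  have hcard : ∀ w ∈ secondCenter P, w ∉ center G → ∃ k, 1 ≤ k ∧
      2 ^ γ * ρ = k * 2 ^ α * Nat.card (core P ⊓ cent w : Subgroup G) := by
    intro w hw hwZ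
    obtain ⟨k, hk, h1⟩ := f.card_core_eq w
    rw [f.cl_eq_of_secondCenter hW hw hwZ, factorization_two_three_mul, hγ] at h1
    exact ⟨k, by rcases hk with rfl | rfl <;> rcases f.e_eq with h | h <;> omega, h1⟩
  have hOZ : ¬ core P ≤ center G := fun h => hcO (h.trans (center_le_cent c))
  obtain ⟨w, hwO, hwZ, hw⟩ := f.exists_mem_secondCenter hα (le_refl (core P))
    (fun u _ n hn => core_conj P u hn) hOZ
  have hwR : w ∉ core P ⊓ cent c := fun h => hwZ (hW w hw h.2)
  have hlt : core P ⊓ cent c < core P ⊓ cent w := lt_of_le_of_ne (hRF.trans (hFw w hw))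
    (fun heq => hwR (heq ▸ ⟨hwO, mem_cent_self w⟩))
  have h2ρ := Nat.le_of_dvd Nat.card_pos (two_mul_card_dvd (core_isPGroup P).to_inf_left hlt)
  -- For `γ = α` the centralizer of `w` in the `2`-core would be no larger than the fixed points.
  have hγα : γ ≠ α := by
    rintro rfl
    obtain ⟨k, hk, h1⟩ := hcard w hw hwZ
    have h3 : 1 * 2 ^ γ * (2 * ρ) ≤ 2 ^ γ * ρ := by
      rw [h1]; exact Nat.mul_le_mul (Nat.mul_le_mul_right _ hk) h2ρ
    have := Nat.mul_pos (hpp γ) hρpos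
    nlinarith
  -- If `F` consisted of fixed points of `c`, these would be normalized by the `2`-core, hence
  -- central.
  have hFR : ¬ secondCentralizer P ≤ core P ⊓ cent c := by
    intro hle
    have heq := le_antisymm hle hRF
    have hRZ : core P ⊓ cent c ≤ center G := by
      by_contra hRZ
      obtain ⟨x, hx, hxZ, hxS⟩ := f.exists_mem_secondCenter hα (N := core P ⊓ cent c) inf_le_left
        (fun u _ n hn => heq ▸ secondCentralizer_conj (heq ▸ hn) u) hRZ
      exact hxZ (hW x hxS hx.2)
    obtain ⟨g, hg⟩ := hatt
    rcases f.cl_eq_of_fixed_central hRZ (g := g) (by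
      rw [hg]; exact not_three_dvd_two_pow α) with h1 | h1
    · rw [h1] at hg
      have := Nat.one_lt_two_pow (show α ≠ 0 by have := f.pos; omega)
      omega
    · rw [hg, hγ3] at h1
      exact hγα (Nat.pow_right_injective le_rfl h1).symm
  obtain ⟨d, hdF, hdR⟩ := SetLike.not_le_iff_exists.1 hFR
  have h4 := f.four_mul_card_le hFO (fun x hx => secondCentralizer_conj hx c) hRF hdF hdR
  have key : ∀ w ∈ secondCenter P, w ∉ center G → 2 ^ α * (4 * ρ) ≤ 2 ^ γ * ρ ∧
      2 ^ α * Nat.card (core P ⊓ cent w : Subgroup G) ≤ 2 ^ γ * ρ := by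
    intro w hw hwZ
    obtain ⟨k, hk, h1⟩ := hcard w hw hwZ
    have h5 := Nat.le_of_dvd Nat.card_pos (card_dvd_of_le (hFw w hw))
    have h6 : 1 * 2 ^ α * Nat.card (core P ⊓ cent w : Subgroup G) ≤ 2 ^ γ * ρ := by
      rw [h1]; exact Nat.mul_le_mul_right _ (Nat.mul_le_mul_right _ hk)
    rw [one_mul] at h6
    exact ⟨(Nat.mul_le_mul_left _ (h4.trans h5)).trans h6, h6⟩
  have hγeq : γ = α + 2 := by
    have h1 := (key w hw hwZ).1
    rw [← mul_assoc] at h1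
    have h3 := Nat.le_of_mul_le_mul_right h1 hρpos
    have h5 : 2 ^ (α + 2) ≤ 2 ^ γ := by rw [pow_add]; exact h3
    have := (Nat.pow_le_pow_iff_right (by norm_num)).1 h5
    omega
  subst hγeq
  have hF4 : ∀ w ∈ secondCenter P, w ∉ center G →
      Nat.card (core P ⊓ cent w : Subgroup G) ≤ 4 * ρ := by
    intro w hw hwZ
    have h1 := (key w hw hwZ).2
    rw [pow_add, mul_assoc] at h1
    exact Nat.le_of_mul_le_mul_left h1 (hpp α)
  refine ⟨hγ, by omega, le_antisymm ?_ h4, fun w hw hwZ => ?_⟩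
  · exact (Nat.le_of_dvd Nat.card_pos (card_dvd_of_le (hFw w hw))).trans (hF4 w hw hwZ)
  · exact (eq_of_le_of_card_ge (hFw w hw) ((hF4 w hw hwZ).trans h4)).symm

/-- The subgroup of elements acting trivially on the quotient of a normal subgroup `N` by a normal
subgroup `F`. -/
def quotientKernel (N F : Subgroup G) [N.Normal] [F.Normal] : Subgroup G where
  carrier := {g | ∀ x ∈ N, g * x * g⁻¹ * x⁻¹ ∈ F}
  one_mem' x _ := by simp
  mul_mem' {a b} ha hb x hx := by
    have h1 := ha _ (Normal.conj_mem inferInstance x hx b)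
    have h2 : a * b * x * (a * b)⁻¹ * x⁻¹ =
        (a * (b * x * b⁻¹) * a⁻¹ * (b * x * b⁻¹)⁻¹) * (b * x * b⁻¹ * x⁻¹) := by group
    rw [h2]
    exact mul_mem h1 (hb x hx)
  inv_mem' {a} ha x hx := by
    have h1 := ha _ (Normal.conj_mem inferInstance x hx a⁻¹)
    have h2 : a⁻¹ * x * a⁻¹⁻¹ * x⁻¹ =
        (a * (a⁻¹ * x * a⁻¹⁻¹) * a⁻¹ * (a⁻¹ * x * a⁻¹⁻¹)⁻¹)⁻¹ := by group
    rw [h2]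
    exact inv_mem h1

instance (N F : Subgroup G) [N.Normal] [F.Normal] : (quotientKernel N F).Normal where
  conj_mem g hg h x hx := by
    have h1 := hg _ (Normal.conj_mem inferInstance x hx h⁻¹)
    have h2 := Normal.conj_mem inferInstance _ h1 h
    have h3 : h * g * h⁻¹ * x * (h * g * h⁻¹)⁻¹ * x⁻¹ =
        h * (g * (h⁻¹ * x * h⁻¹⁻¹) * g⁻¹ * (h⁻¹ * x * h⁻¹⁻¹)⁻¹) * h⁻¹ := by group
    rw [h3]
    exact h2

/-- Let `F` be a normal subgroup of `G` inside the `2`-core that contains the fixed points of `c`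
and all commutators of `P`. The elements acting trivially on `O₂(G) / F` form a normal subgroup of
index `1` or `3`. Index `3` would make `P` normal, against `|P : O₂(G)| = 2`; for index `1` every
coset of `F` in the `2`-core contains a fixed point of `c`, so `F` is the `2`-core. -/
theorem core_le_of_commutator_mem [Finite G] (f : Frame α δ 2 P c) (F : Subgroup G) [F.Normal]
    (hFO : F ≤ core P) (hRF : core P ⊓ cent c ≤ F)
    (hcomm : ∀ a ∈ P, ∀ b ∈ P, a * b * a⁻¹ * b⁻¹ ∈ F) : core P ≤ F := by
  set K := quotientKernel (core P) F with hK
  have hOP : core P ≤ P := normalCore_le _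
  have hle : (P : Subgroup G) ⊔ center G ≤ K := by
    refine sup_le (fun a ha x hx => hcomm a ha x (hOP hx)) (fun z hz x _ => ?_)
    rw [mem_cent_iff_conj.1 (center_le_cent x hz), mul_inv_cancel]
    exact one_mem _
  have hidx : K.index ∣ 3 := (index_dvd_of_le hle).trans f.index_dvd
  rcases (Nat.dvd_prime Nat.prime_three).1 hidx with h1 | h1
  · intro x hx
    have hcK : c ∈ K := by rw [index_eq_one.1 h1]; trivial
    have h2 := Normal.conj_mem (inferInstance : F.Normal) _ (hcK x hx) x⁻¹
    have h3 : x⁻¹ * (c * x * c⁻¹ * x⁻¹) * x⁻¹⁻¹ = x⁻¹ * (c * x * c⁻¹) := by group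
    rw [h3] at h2
    obtain ⟨n, hn, hnc⟩ := exists_mul_mem_cent f.c_three ((core_isPGroup P).to_le hFO)
      (fun y hy => Normal.conj_mem inferInstance y hy c) h2
    have h4 := mul_mem (hRF ⟨mul_mem hx (hFO hn), hnc⟩) (inv_mem hn)
    rwa [mul_inv_cancel_right] at h4
  · exfalso
    have hKeq : (P : Subgroup G) ⊔ center G = K := by
      have h2 := relIndex_mul_index hle
      have h3 : ((P : Subgroup G) ⊔ center G).index = 3 := by
        rcases (Nat.dvd_prime Nat.prime_three).1 f.index_dvd with h | h
        · rw [h, h1] at h2; omega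
        · exact h
      rw [h1, h3] at h2
      exact le_antisymm hle (relIndex_eq_one.1 (by omega))
    have hPO : (P : Subgroup G) ≤ core P := by
      intro x hx g
      have h2 : g * x * g⁻¹ ∈ K := Normal.conj_mem inferInstance x (hle (mem_sup_left hx)) g
      rw [← hKeq, ← SetLike.mem_coe, mul_normal] at h2
      obtain ⟨p, hp, z, hz, hpz⟩ := h2
      simp only at hpz
      have hz2 : IsPElem 2 z := by
        have h3 : z = p⁻¹ * (g * x * g⁻¹) := by rw [← hpz]; group
        rw [h3]
        refine (P.2.isPElem hp).inv.mul ((P.2.isPElem hx).conj g) (inv_mem ?_)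
        rw [← hpz]
        exact mem_cent_comm.1 (mul_mem (mem_cent_self _) (center_le_cent _ hz))
      rw [← hpz]
      exact mul_mem hp (mem_sylow_of_center P hz hz2)
    have h2 := f.card_P
    have h3 : (P : Subgroup G) = core P := le_antisymm hPO hOP
    have h4 : Nat.card (P : Subgroup G) = Nat.card (core P) := by rw [← h3]
    have hpos : 0 < Nat.card (core P) := Nat.card_pos
    change Nat.card (P : Subgroup G) = 2 * Nat.card (core P) at h2
    omega

/-- The case `|P : O₂(G)| = 2` cannot occur for `α ≥ 2` once `secondCenter P` meets the fixed points
of `c` centrally. The centralizer `F` of `secondCenter P` in the `2`-core is abelian and equals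
`C_P(u)` for each noncentral `u ∈ F`. Choosing `u` central in `P` modulo the centre shows that `F`
contains all commutators of `P`, so `F` is the whole `2`-core, which is too large. -/
theorem not_of_secondCenter [Finite G] (f : Frame α δ 2 P c) (hα : 2 ≤ α) (hδ : δ ≤ α + 2)
    (hcO : ¬ core P ≤ cent c) (hW : ∀ w ∈ secondCenter P, w ∈ cent c → w ∈ center G)
    (hatt : ∃ g : G, cl g = 2 ^ α) : False := by
  obtain ⟨hγ, hδ', hF4, hFw⟩ := f.secondCentralizer_eq (Or.inr hα) hδ hcO hW hatt
  subst hδ'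
  set F := secondCentralizer P with hF
  have hRF : core P ⊓ cent c ≤ F := f.fixed_le_secondCentralizer hW
  have hFO : F ≤ core P := inf_le_left
  have hFn : F.Normal := ⟨fun n hn g => secondCentralizer_conj hn g⟩
  have hρpos : 0 < Nat.card (core P ⊓ cent c : Subgroup G) := Nat.card_pos
  obtain ⟨w, hwO, hwZ, hw⟩ := f.exists_mem_secondCenter (Or.inr hα) (le_refl (core P))
    (fun u _ n hn => core_conj P u hn) (fun h => hcO (h.trans (center_le_cent c)))
  have hwR : w ∉ core P ⊓ cent c := fun h => hwZ (hW w hw h.2)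
  have hwF : w ∈ F := by rw [← hFw w hw hwZ]; exact ⟨hwO, mem_cent_self w⟩
  -- The index of the fixed points in `F` being four, nothing `c`-invariant lies strictly between.
  have hfull : ∀ Y ≤ F, (∀ x ∈ Y, c * x * c⁻¹ ∈ Y) → core P ⊓ cent c ≤ Y → w ∈ Y → Y = F := by
    intro Y hY hcY hRY hwY
    have := f.four_mul_card_le (hY.trans hFO) hcY hRY hwY hwR
    exact eq_of_le_of_card_ge hY (by omega)
  -- The fixed points of `c` commute with `F`.
  have hY : ∀ r ∈ core P ⊓ cent c, F ≤ cent r := by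
    intro r hr
    rw [← hfull (F ⊓ cent r) inf_le_left (fun x hx => ⟨hFn.conj_mem x hx.1 c,
      (core_cent_conj_mem hr.2 ⟨hFO hx.1, hx.2⟩).2⟩)
      (le_inf hRF (f.commute_of_cl_max hγ hr).1) ⟨hwF, f.commute_of_secondCenter hW hw hr⟩]
    exact inf_le_right
  -- Hence `F` is abelian.
  have hab : ∀ a ∈ F, F ≤ cent a := by
    have h1 := hfull (F ⊓ centralizer (F : Set G)) inf_le_left ?_ ?_ ?_
    · intro a ha b hb
      rw [← h1] at hb
      exact mem_cent.2 (mem_centralizer_iff.1 hb.2 a ha).symm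
    · intro x hx
      have hm : ∀ y ∈ F, x ∈ cent y := fun y hy =>
        mem_cent.2 (mem_centralizer_iff.1 hx.2 y hy).symm
      refine mem_inf.2 ⟨hFn.conj_mem x hx.1 c, mem_centralizer_iff.2 fun y hy => ?_⟩
      have h2 := conj_mem_cent c (hm _ (hFn.conj_mem y hy c⁻¹))
      have h3 : c * (c⁻¹ * y * c⁻¹⁻¹) * c⁻¹ = y := by group
      rw [h3] at h2
      exact (mem_cent.1 h2).symm
    · exact fun r hr => ⟨hRF hr, mem_centralizer_iff.2 fun y hy => mem_cent.1 (hY r hr hy)⟩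
    · exact ⟨hwF, mem_centralizer_iff.2 fun y hy =>
        mem_cent.1 ((mem_secondCentralizer.1 hy).2 w hw)⟩
  have hcP : Nat.card P = 2 ^ α * Nat.card F := by
    have h1 : Nat.card P = 2 * Nat.card (core P) := f.card_P
    rw [h1, hγ, hF4, pow_add]; ring
  have hOP : core P ≤ P := normalCore_le _
  have hPu : ∀ u ∈ F, u ∉ center G → (P : Subgroup G) ⊓ cent u = F := by
    intro u hu huZ
    have h1 := card_mul_pPart_dvd P (x := u) (T := P ⊓ cent u) P.2.to_inf_left inf_le_right
    rcases f.factorization_eq_zero_or u with h | h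
    · exact absurd h huZ
    · have h2 := Nat.le_of_dvd Nat.card_pos ((mul_dvd_mul_left _ (pow_dvd_pow 2 h)).trans h1)
      rw [hcP, mul_comm] at h2
      have h3 := Nat.le_of_mul_le_mul_left h2 (by positivity)
      exact (eq_of_le_of_card_ge (le_inf (hFO.trans hOP) (hab u hu)) h3).symm
  -- An element of `F` that is central in `P` modulo the centre embeds `P / F` into the centre.
  have hcen : ∀ x : (P : Subgroup G), x ∈ center (P : Subgroup G) ↔ (x : G) ∈ center G := by
    intro x
    constructor
    · intro hx
      apply f.mem_center_of_sylow_le P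
      intro u hu
      exact mem_cent.2 (congrArg Subtype.val (Subgroup.mem_center_iff.1 hx ⟨u, hu⟩))
    · intro hx
      rw [Subgroup.mem_center_iff]
      intro g
      exact Subtype.ext (Subgroup.mem_center_iff.1 hx g)
  have hsn : (F.subgroupOf (P : Subgroup G)).Normal := inferInstance
  obtain ⟨u, hu, huc, huu⟩ := exists_secondCenter P.2 (F.subgroupOf (P : Subgroup G))
    (fun hle => hwZ ((hcen ⟨w, hOP hwO⟩).1 (hle hwF)))
  have huF : (u : G) ∈ F := hu
  have huZ : (u : G) ∉ center G := fun h => huc ((hcen u).2 h)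
  have hcomm : ∀ a ∈ P, ∀ b ∈ P, a * b * a⁻¹ * b⁻¹ ∈ F := by
    intro a ha b hb
    rw [← hPu u huF huZ]
    refine mem_inf.2 ⟨mul_mem (mul_mem (mul_mem ha hb) (inv_mem ha)) (inv_mem hb), ?_⟩
    have hk : ∀ t ∈ P, ∃ z ∈ center G, (u : G) * t * (u : G)⁻¹ = z * t := by
      intro t ht
      exact ⟨_, (hcen _).1 (huu ⟨t, ht⟩), by simp⟩
    obtain ⟨y, hy, hya⟩ := hk a ha
    obtain ⟨z, hz, hzb⟩ := hk b hb
    apply mem_cent_comm.1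
    rw [mem_cent_iff_conj]
    have hyc : ∀ g, y * g = g * y := fun g => mem_cent.1 (center_le_cent g hy)
    have hzc : ∀ g, z * g = g * z := fun g => mem_cent.1 (center_le_cent g hz)
    calc (u : G) * (a * b * a⁻¹ * b⁻¹) * (u : G)⁻¹
        = (u * a * (u : G)⁻¹) * (u * b * (u : G)⁻¹) * (u * a * (u : G)⁻¹)⁻¹ *
          (u * b * (u : G)⁻¹)⁻¹ := by group
      _ = (y * a) * (z * b) * (y * a)⁻¹ * (z * b)⁻¹ := by rw [hya, hzb]
      _ = a * b * a⁻¹ * b⁻¹ := by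
        rw [hyc a, hzc b]
        have e1 : y * (b * z) = b * z * y := hyc _
        calc a * y * (b * z) * (a * y)⁻¹ * (b * z)⁻¹
            = a * (y * (b * z)) * y⁻¹ * a⁻¹ * z⁻¹ * b⁻¹ := by group
          _ = a * b * (z * a⁻¹) * z⁻¹ * b⁻¹ := by rw [e1]; group
          _ = _ := by rw [hzc]; group
  have hOF := f.core_le_of_commutator_mem F hFO hRF hcomm
  have h1 := Nat.le_of_dvd Nat.card_pos (card_dvd_of_le hOF)
  have h2 : Nat.card P = 2 * Nat.card (core P) := f.card_P
  have h3 : 2 ^ 2 ≤ 2 ^ α := Nat.pow_le_pow_right (by norm_num) hα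
  have h4 : 2 ^ 2 * Nat.card F ≤ 2 ^ α * Nat.card F := Nat.mul_le_mul_right _ h3
  have h5 : 0 < Nat.card F := Nat.card_pos
  omega

end Frame

/-! ### The exponent `α` -/

/-- If `2 ^ α` is a class size and no class size is a power of two above `2 ^ (α + 1)`, then `c`, in
any `Frame`, centralizes the `2`-core, whence both conclusions. -/
theorem SizeBound.first_case [Finite G] {α : ℕ} (h : SizeBound G α (α + 1))
    (h0 : ∃ g : G, cl g = 2 ^ α) : α = 1 ∧ ∀ S : Sylow 3 G, (S : Subgroup G).Normal := by
  obtain ⟨P⟩ : Nonempty (Sylow 2 G) := inferInstance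
  obtain ⟨e, c, f⟩ := h.exists_frame P
  by_cases hcO : core P ≤ cent c
  · exact ⟨(f.cl_c_eq_two hcO).2.1, fun S => f.sylow_three_normal hcO S⟩
  exfalso
  obtain ⟨γ, hγ1, hγ2, hγ3, hγ⟩ := f.cl_c
  obtain ⟨m, hm, hpar⟩ := f.exists_parity hγ
  have hpos := f.pos
  have hm0 : m ≠ 0 := by
    rintro rfl
    rw [pow_zero, one_mul] at hm
    exact hcO (inf_eq_left.1 (eq_of_le_of_card_ge inf_le_left hm.le))
  have hpw : ∀ {a b : ℕ}, 2 ^ a ≤ 2 ^ b → a ≤ b := fun hab =>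
    (Nat.pow_le_pow_iff_right (by norm_num)).1 hab
  by_cases hα : α = 1
  · obtain ⟨rfl, hγm⟩ | ⟨rfl, hγm⟩ := hpar
    · -- Here `c` has class size four.  A class of size two would give a fixed point `r` of `c`
      -- whose centralizer has index two in the `2`-core, but contains all fixed points of `c` with
      -- index a power of four.
      have hm1 : m = 1 := by omega
      subst hα
      have hγδ : γ = 1 + 1 := by omega
      subst hγδ
      obtain ⟨g, hg⟩ := h0
      obtain ⟨r, hr, hcl⟩ := f.cl_cases (g := g) (by rw [hg]; norm_num)
      obtain ⟨hRr, hcl2⟩ := f.commute_of_cl_max hγ hr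
      rcases hcl with hcl | hcl
      · obtain ⟨k, hk, hkk⟩ := f.card_core_eq r
        have hk1 : k = 1 := by omega
        rw [← hcl, hg, factorization_two_pow, hk1] at hkk
        obtain ⟨j, hj⟩ := exists_card_eq_four_pow f.c_three
          ((core_isPGroup P).to_inf_left : IsPGroup 2 (core P ⊓ cent r : Subgroup G))
          (fun x hx => Frame.core_cent_conj_mem hr.2 hx)
        have heq : core P ⊓ cent r ⊓ cent c = core P ⊓ cent c :=
          le_antisymm (inf_le_inf_right _ inf_le_left)
            (le_inf (le_inf inf_le_left hRr) inf_le_right)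
        have hρ : 0 < Nat.card (core P ⊓ cent c : Subgroup G) := Nat.card_pos
        rw [heq] at hj
        rw [hj, hm, hm1, ← mul_assoc, ← mul_assoc] at hkk
        have h5 := Nat.eq_of_mul_eq_mul_right hρ hkk
        rcases j with _ | j
        · norm_num at h5
        · rw [pow_succ] at h5
          have : 0 < 4 ^ j := by positivity
          omega
      · rw [hg, hcl2] at hcl
        norm_num at hcl
    · omega
  · have hα2 : 2 ≤ α := by omega
    have hW : ∀ w ∈ secondCenter P, w ∈ cent c → w ∈ center G := by
      intro w hw hwc
      rcases f.mem_center_or_le hγ hw hwc with h1 | h1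
      · exact h1
      · exfalso
        obtain ⟨rfl, hγm⟩ | ⟨rfl, hγm⟩ := hpar
        · rw [one_mul] at h1
          have := hpw h1
          omega
        · rw [← pow_succ'] at h1
          have := hpw h1
          omega
    -- The class size of `c` would be `2 ^ (α + 2)`, which is excluded here.
    have := (f.secondCentralizer_eq (Or.inr hα2) (by omega) hcO hW h0).2.1
    omega

/-- If `2 ^ α`, `2 ^ (α + 1)`, `2 ^ (α + 2)` are class sizes and no class size is a larger power of
two, then for odd `α` the `2`-core is a Sylow `2`-subgroup. -/
theorem SizeBound.second_case [Finite G] {α : ℕ} (h : SizeBound G α (α + 2)) (hodd : Odd α)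
    (h0 : ∃ g : G, cl g = 2 ^ α) (h1 : ∃ g : G, cl g = 2 ^ (α + 1))
    (h2 : ∃ g : G, cl g = 2 ^ (α + 2)) :
    α = 1 ∧ ∀ P : Sylow 2 G, (P : Subgroup G).Normal := by
  have key : ∀ P : Sylow 2 G, α = 1 ∧ (P : Subgroup G).Normal := by
    intro P
    obtain ⟨e, c, f⟩ := h.exists_frame P
    obtain ⟨a, ha⟩ := hodd
    by_cases hcO : core P ≤ cent c
    · exfalso
      obtain ⟨g, hg⟩ := h2
      rw [(f.cl_c_eq_two hcO).2.1] at hg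
      exact f.cl_ne_eight hcO g hg
    obtain ⟨γ, hγ1, hγ2, hγ3, hγ⟩ := f.cl_c
    obtain ⟨m, hm, hpar⟩ := f.exists_parity hγ
    have hm0 : m ≠ 0 := by
      rintro rfl
      rw [pow_zero, one_mul] at hm
      exact hcO (inf_eq_left.1 (eq_of_le_of_card_ge inf_le_left hm.le))
    have hpw : ∀ {a b : ℕ}, 2 ^ a ≤ 2 ^ b → a ≤ b := fun hab =>
      (Nat.pow_le_pow_iff_right (by norm_num)).1 hab
    -- The exponent `γ` lies between `α` and `α + 2` and has the parity of `e + 1`.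
    obtain ⟨rfl, hγm⟩ | ⟨rfl, hγm⟩ := hpar
    · by_cases hα : α = 1
      · refine ⟨hα, ?_⟩
        have h3 := f.card_P
        rw [one_mul] at h3
        have h4 : (P : Subgroup G).normalCore = P :=
          eq_of_le_of_card_ge (normalCore_le _) h3.le
        rw [← h4]
        exact normalCore_normal _
      · exfalso
        have hW : ∀ w ∈ secondCenter P, w ∈ cent c → w ∈ center G := by
          intro w hw hwc
          rcases f.mem_center_or_le hγ hw hwc with h1 | h1
          · exact h1
          · exfalso
            rw [one_mul] at h1
            have := hpw h1
            omega
        have h3 := (f.secondCentralizer_eq (Or.inl rfl) le_rfl hcO hW h0).1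
        rw [hγ] at h3
        -- Now `γ = α + 2` is odd, while it equals `2 * m`.
        have h4 := Nat.pow_right_injective le_rfl (Nat.eq_of_mul_eq_mul_right Nat.card_pos h3)
        omega
    · exfalso
      by_cases hm1 : m = 1
      · subst hm1
        rw [pow_one] at hm
        have h3 := f.alpha_lt_three hm
        have hα : α = 1 := by omega
        subst hα
        obtain ⟨g, hg⟩ := h1
        exact f.cl_ne_four hm g hg
      · have hW : ∀ w ∈ secondCenter P, w ∈ cent c → w ∈ center G := by
          intro w hw hwc
          rcases f.mem_center_or_le hγ hw hwc with h1 | h1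
          · exact h1
          · exfalso
            rw [← pow_succ'] at h1
            have := hpw h1
            omega
        exact f.not_of_secondCenter (by omega) le_rfl hcO hW h0
  obtain ⟨P⟩ : Nonempty (Sylow 2 G) := inferInstance
  exact ⟨(key P).1, fun P => (key P).2⟩

/-! ### Groups of order `96` -/

/-- The set of class sizes in terms of indices of centralizers. -/
theorem cs_eq_range_cl (G : Type*) [Group G] [Finite G] : cs G = Set.range (cl : G → ℕ) :=
  congrArg Set.range (funext ncard_conjugatesOf)

theorem cl_mulEquiv {G H : Type*} [Group G] [Group H] (e : G ≃* H) (x : G) :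
    cl (e x) = cl x := by
  have h : (cent (e x)).comap (e : G →* H) = cent x := by
    ext g
    simp only [Subgroup.mem_comap, mem_cent, MonoidHom.coe_coe, ← map_mul, e.injective.eq_iff]
  rw [cl, cl, ← h, Subgroup.index_comap_of_surjective _ e.surjective]

theorem cs_congr {G H : Type*} [Group G] [Group H] [Finite G] (e : G ≃* H) : cs H = cs G := by
  have : Finite H := Finite.of_equiv G e.toEquiv
  rw [cs_eq_range_cl, cs_eq_range_cl, ← e.surjective.range_comp]
  exact congrArg Set.range (funext (cl_mulEquiv e))

theorem cl_mul_card_filter {G : Type*} [Group G] [Fintype G] [DecidableEq G] (p : G) :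
    cl p * (Finset.univ.filter fun q => q * p = p * q).card = Fintype.card G := by
  have h : Nat.card (cent p) = (Finset.univ.filter fun q => q * p = p * q).card := by
    rw [← Fintype.card_subtype, ← Nat.card_eq_fintype_card]
    exact Nat.card_congr (Equiv.subtypeEquivRight fun q => mem_cent)
  rw [← h, ← Nat.card_eq_fintype_card]
  exact Subgroup.index_mul_card _

/-- Underlying set of a group of order `96`, the semidirect product of a cyclic group of order `3`
by an extraspecial group of order `32`, in which only the coordinate `a` acts nontrivially. -/
structure SplitNinetySix where
  x : ZMod 3
  a : ZMod 2
  b : ZMod 2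
  c : ZMod 2
  d : ZMod 2
  z : ZMod 2
  deriving DecidableEq

namespace SplitNinetySix

/-- The nontrivial action of the group of order `2` on the group of order `3`, as a sign. -/
def sgn (a : ZMod 2) : ZMod 3 := if a = 0 then 1 else -1

theorem sgn_add : ∀ a b, sgn (a + b) = sgn a * sgn b := by decide

/-- The five binary coordinates multiply as in a central product of two dihedral groups of order
`8`, with cocycle `b * a' + d * c'`. -/
instance : Mul SplitNinetySix :=
  ⟨fun p q => ⟨p.x + sgn p.a * q.x, p.a + q.a, p.b + q.b, p.c + q.c, p.d + q.d,
    p.z + q.z + p.b * q.a + p.d * q.c⟩⟩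

instance : One SplitNinetySix := ⟨⟨0, 0, 0, 0, 0, 0⟩⟩

instance : Inv SplitNinetySix :=
  ⟨fun p => ⟨-(sgn (-p.a) * p.x), -p.a, -p.b, -p.c, -p.d, -p.z + p.b * p.a + p.d * p.c⟩⟩

theorem mul_def (p q : SplitNinetySix) : p * q = ⟨p.x + sgn p.a * q.x, p.a + q.a, p.b + q.b,
    p.c + q.c, p.d + q.d, p.z + q.z + p.b * q.a + p.d * q.c⟩ := rfl

theorem inv_def (p : SplitNinetySix) : p⁻¹ = ⟨-(sgn (-p.a) * p.x), -p.a, -p.b, -p.c, -p.d,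
    -p.z + p.b * p.a + p.d * p.c⟩ := rfl

theorem one_def : (1 : SplitNinetySix) = ⟨0, 0, 0, 0, 0, 0⟩ := rfl

instance : Group SplitNinetySix :=
  Group.ofLeftAxioms
    (fun p q r => by
      simp only [mul_def, sgn_add, mk.injEq]
      refine ⟨?_, ?_, ?_, ?_, ?_, ?_⟩ <;> ring)
    (fun p => by
      have h : sgn 0 = 1 := rfl
      simp only [mul_def, one_def, h, zero_add, one_mul, zero_mul, add_zero])
    (fun p => by
      simp only [mul_def, one_def, inv_def, mk.injEq]
      refine ⟨?_, ?_, ?_, ?_, ?_, ?_⟩ <;> ring)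

/-- The coordinates of an element, as a tuple. -/
def equivProd : SplitNinetySix ≃ ZMod 3 × ZMod 2 × ZMod 2 × ZMod 2 × ZMod 2 × ZMod 2 where
  toFun p := (p.x, p.a, p.b, p.c, p.d, p.z)
  invFun p := ⟨p.1, p.2.1, p.2.2.1, p.2.2.2.1, p.2.2.2.2.1, p.2.2.2.2.2⟩
  left_inv _ := rfl
  right_inv _ := rfl

instance : Fintype SplitNinetySix := Fintype.ofEquiv _ equivProd.symm

theorem card_eq : Fintype.card SplitNinetySix = 96 := by
  rw [Fintype.card_congr equivProd]
  simp [ZMod.card]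

set_option maxRecDepth 100000 in
theorem card_filter_commute (p : SplitNinetySix) :
    (Finset.univ.filter fun q => q * p = p * q).card ∈ ({96, 48, 24, 16} : Finset ℕ) := by
  revert p
  decide +kernel

theorem cs_eq : cs SplitNinetySix = {1, 2, 4, 6} := by
  -- Class sizes are read off from orders of centralizers in a group of order `96`.
  have key := fun p => card_eq ▸ cl_mul_card_filter (G := SplitNinetySix) p
  rw [cs_eq_range_cl]
  apply Set.Subset.antisymm
  · rintro _ ⟨p, rfl⟩
    have h1 := key p
    have h2 := card_filter_commute p
    simp only [Finset.mem_insert, Finset.mem_singleton] at h2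
    simp only [Set.mem_insert_iff, Set.mem_singleton_iff]
    rcases h2 with h | h | h | h <;> rw [h] at h1 <;> omega
  · rintro n (rfl | rfl | rfl | rfl)
    · refine ⟨⟨0, 0, 0, 0, 0, 0⟩, Nat.eq_of_mul_eq_mul_right (m := 96) (by norm_num) ?_⟩
      exact key _
    · refine ⟨⟨0, 0, 0, 1, 0, 0⟩, Nat.eq_of_mul_eq_mul_right (m := 48) (by norm_num) ?_⟩
      exact key _
    · refine ⟨⟨1, 0, 0, 1, 0, 0⟩, Nat.eq_of_mul_eq_mul_right (m := 24) (by norm_num) ?_⟩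
      exact key _
    · refine ⟨⟨0, 1, 0, 0, 0, 0⟩, Nat.eq_of_mul_eq_mul_right (m := 16) (by norm_num) ?_⟩
      exact key _

end SplitNinetySix

/-- Underlying set of a group of order `96`, a central product of `SL(2, 3)` and a dihedral group
of order `8`.  The coordinates `j` and `v` describe `SL(2, 3)` modulo its centre, `a` and `b`
describe the dihedral group modulo its centre, and `z` is the common centre. -/
structure CentralProduct where
  j : ZMod 3
  v : ZMod 2 × ZMod 2
  a : ZMod 2
  b : ZMod 2
  z : ZMod 2
  deriving DecidableEq

namespace CentralProduct

/-- The action of the group of order `3` on a plane over the field with two elements. -/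
def rot (j : ZMod 3) (v : ZMod 2 × ZMod 2) : ZMod 2 × ZMod 2 :=
  if j = 0 then v else if j = 1 then (v.2, v.1 + v.2) else (v.1 + v.2, v.1)

/-- A bilinear form invariant under `rot`, with `form v v ≠ 0` for all `v ≠ 0`; it is the cocycle
of the quaternion group of order `8`. -/
def form (v w : ZMod 2 × ZMod 2) : ZMod 2 := v.1 * w.1 + v.2 * w.1 + v.2 * w.2

theorem form_add_left (u v w) : form (u + v) w = form u w + form v w := by
  simp only [form, Prod.fst_add, Prod.snd_add]
  ring

theorem form_add_right (u v w) : form u (v + w) = form u v + form u w := by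
  simp only [form, Prod.fst_add, Prod.snd_add]
  ring

theorem form_rot : ∀ j v w, form (rot j v) (rot j w) = form v w := by decide

theorem rot_rot : ∀ i j v, rot (i + j) v = rot i (rot j v) := by decide

theorem rot_add : ∀ j v w, rot j (v + w) = rot j v + rot j w := by decide

theorem rot_zero (v) : rot 0 v = v := rfl

theorem form_zero_left (v) : form 0 v = 0 := by simp [form]

theorem form_neg_left (v w) : form (-v) w = -form v w := by
  simp only [form, Prod.fst_neg, Prod.snd_neg]
  ring

instance : Mul CentralProduct :=
  ⟨fun p q => ⟨p.j + q.j, p.v + rot p.j q.v, p.a + q.a, p.b + q.b,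
    p.z + q.z + form p.v (rot p.j q.v) + p.b * q.a⟩⟩

instance : One CentralProduct := ⟨⟨0, 0, 0, 0, 0⟩⟩

instance : Inv CentralProduct :=
  ⟨fun p => ⟨-p.j, -rot (-p.j) p.v, -p.a, -p.b, -p.z + form p.v p.v + p.b * p.a⟩⟩

theorem mul_def (p q : CentralProduct) : p * q = ⟨p.j + q.j, p.v + rot p.j q.v, p.a + q.a,
    p.b + q.b, p.z + q.z + form p.v (rot p.j q.v) + p.b * q.a⟩ := rfl

theorem inv_def (p : CentralProduct) : p⁻¹ = ⟨-p.j, -rot (-p.j) p.v, -p.a, -p.b,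
    -p.z + form p.v p.v + p.b * p.a⟩ := rfl

theorem one_def : (1 : CentralProduct) = ⟨0, 0, 0, 0, 0⟩ := rfl

instance : Group CentralProduct :=
  Group.ofLeftAxioms
    (fun p q r => by
      simp only [mul_def, mk.injEq, rot_rot, rot_add, form_add_left, form_add_right, form_rot]
      refine ⟨?_, ?_, ?_, ?_, ?_⟩ <;> ring)
    (fun p => by
      simp only [mul_def, one_def, rot_zero, zero_add, zero_mul, add_zero, form_zero_left])
    (fun p => by
      simp only [mul_def, one_def, inv_def, mk.injEq, form_neg_left, form_rot]
      refine ⟨?_, ?_, ?_, ?_, ?_⟩ <;> ring)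

/-- The coordinates of an element, as a tuple. -/
def equivProd : CentralProduct ≃ ZMod 3 × (ZMod 2 × ZMod 2) × ZMod 2 × ZMod 2 × ZMod 2 where
  toFun p := (p.j, p.v, p.a, p.b, p.z)
  invFun p := ⟨p.1, p.2.1, p.2.2.1, p.2.2.2.1, p.2.2.2.2⟩
  left_inv _ := rfl
  right_inv _ := rfl

instance : Fintype CentralProduct := Fintype.ofEquiv _ equivProd.symm

theorem card_eq : Fintype.card CentralProduct = 96 := by
  rw [Fintype.card_congr equivProd]
  simp [ZMod.card]

set_option maxRecDepth 100000 in
theorem card_filter_commute (p : CentralProduct) :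
    (Finset.univ.filter fun q => q * p = p * q).card ∈ ({96, 48, 24, 16, 12} : Finset ℕ) := by
  revert p
  decide +kernel

theorem cs_eq : cs CentralProduct = {1, 2, 4, 6, 8} := by
  -- Class sizes are read off from orders of centralizers in a group of order `96`.
  have key := fun p => card_eq ▸ cl_mul_card_filter (G := CentralProduct) p
  rw [cs_eq_range_cl]
  apply Set.Subset.antisymm
  · rintro _ ⟨p, rfl⟩
    have h1 := key p
    have h2 := card_filter_commute p
    simp only [Finset.mem_insert, Finset.mem_singleton] at h2
    simp only [Set.mem_insert_iff, Set.mem_singleton_iff]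
    rcases h2 with h | h | h | h | h <;> rw [h] at h1 <;> omega
  · rintro n (rfl | rfl | rfl | rfl | rfl)
    · refine ⟨⟨0, 0, 0, 0, 0⟩, Nat.eq_of_mul_eq_mul_right (m := 96) (by norm_num) ?_⟩
      exact key _
    · refine ⟨⟨0, 0, 1, 0, 0⟩, Nat.eq_of_mul_eq_mul_right (m := 48) (by norm_num) ?_⟩
      exact key _
    · refine ⟨⟨1, 0, 0, 0, 0⟩, Nat.eq_of_mul_eq_mul_right (m := 24) (by norm_num) ?_⟩
      exact key _
    · refine ⟨⟨0, (1, 0), 0, 0, 0⟩, Nat.eq_of_mul_eq_mul_right (m := 16) (by norm_num) ?_⟩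
      exact key _
    · refine ⟨⟨1, 0, 1, 0, 0⟩, Nat.eq_of_mul_eq_mul_right (m := 12) (by norm_num) ?_⟩
      exact key _

end CentralProduct

/-! ### Translation to the set of class sizes -/

variable [Finite G] {α : ℕ}

theorem exists_cl_eq {S : Set ℕ} (h : cs G = S) {n : ℕ} (hn : n ∈ S) : ∃ g : G, cl g = n := by
  rw [← h, cs_eq_range_cl] at hn
  exact hn

theorem sizeBound_succ (hα : 1 ≤ α) (h : cs G = {1, 2 ^ α, 2 ^ (α + 1), 2 ^ α * 3}) :
    SizeBound G α (α + 1) where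
  pos := hα
  size x := by
    have hx : cl x ∈ cs G := cs_eq_range_cl G ▸ Set.mem_range_self x
    rw [h, mul_comm _ 3] at hx
    rcases hx with hx | hx | hx | hx
    · exact Or.inl hx
    · exact Or.inr (Or.inr ⟨α, le_rfl, by omega, hx⟩)
    · exact Or.inr (Or.inr ⟨α + 1, by omega, le_rfl, hx⟩)
    · exact Or.inr (Or.inl hx)
  attained := exists_cl_eq h (by simp [mul_comm])

theorem sizeBound_add_two (hα : 1 ≤ α)
    (h : cs G = {1, 2 ^ α, 2 ^ (α + 1), 2 ^ α * 3, 2 ^ (α + 2)}) : SizeBound G α (α + 2) where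
  pos := hα
  size x := by
    have hx : cl x ∈ cs G := cs_eq_range_cl G ▸ Set.mem_range_self x
    rw [h, mul_comm _ 3] at hx
    rcases hx with hx | hx | hx | hx | hx
    · exact Or.inl hx
    · exact Or.inr (Or.inr ⟨α, le_rfl, by omega, hx⟩)
    · exact Or.inr (Or.inr ⟨α + 1, by omega, by omega, hx⟩)
    · exact Or.inr (Or.inl hx)
    · exact Or.inr (Or.inr ⟨α + 2, by omega, le_rfl, hx⟩)
  attained := exists_cl_eq h (by simp [mul_comm])

theorem eq_one_and_normal_of_cs_succ (hα : 1 ≤ α)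
    (h : cs G = {1, 2 ^ α, 2 ^ (α + 1), 2 ^ α * 3}) :
    α = 1 ∧ ∀ P : Sylow 3 G, (P : Subgroup G).Normal :=
  (sizeBound_succ hα h).first_case (exists_cl_eq h (by simp))

theorem eq_one_and_normal_of_cs_add_two (hα : 1 ≤ α) (hodd : Odd α)
    (h : cs G = {1, 2 ^ α, 2 ^ (α + 1), 2 ^ α * 3, 2 ^ (α + 2)}) :
    α = 1 ∧ ∀ P : Sylow 2 G, (P : Subgroup G).Normal :=
  (sizeBound_add_two hα h).second_case hodd (exists_cl_eq h (by simp))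
    (exists_cl_eq h (by simp)) (exists_cl_eq h (by simp))

end ClassSize

theorem mainTheorem1 :
    (∀ α : ℕ, 1 ≤ α →
      ((∃ (G : Type u) (_ : Group G), Finite G ∧
          cs G = {1, 2 ^ α, 2 ^ (α + 1), 2 ^ α * 3}) ↔ α = 1)) ∧
    (∀ α : ℕ, 1 ≤ α →
      ((∃ (G : Type u) (_ : Group G), Finite G ∧
          cs G = {1, 2 ^ α, 2 ^ (α + 1), 2 ^ α * 3, 2 ^ (α + 2)} ∧ Odd α) ↔ α = 1)) ∧
    (∀ (G : Type u) [Group G] [Finite G], cs G = {1, 2, 4, 6} →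
      ∀ P : Sylow 3 G, (P : Subgroup G).Normal) ∧
    (∀ (G : Type u) [Group G] [Finite G], cs G = {1, 2, 4, 6, 8} →
      ∀ P : Sylow 2 G, (P : Subgroup G).Normal) := by
  refine ⟨fun α hα => ⟨?_, ?_⟩, fun α hα => ⟨?_, ?_⟩, ?_, ?_⟩
  · rintro ⟨G, _, _, h⟩
    exact (ClassSize.eq_one_and_normal_of_cs_succ hα h).1
  · rintro rfl
    refine ⟨ULift ClassSize.SplitNinetySix, inferInstance, inferInstance, ?_⟩
    rw [ClassSize.cs_congr MulEquiv.ulift.symm, ClassSize.SplitNinetySix.cs_eq]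
    norm_num
  · rintro ⟨G, _, _, h, hodd⟩
    exact (ClassSize.eq_one_and_normal_of_cs_add_two hα hodd h).1
  · rintro rfl
    refine ⟨ULift ClassSize.CentralProduct, inferInstance, inferInstance, ?_, odd_one⟩
    rw [ClassSize.cs_congr MulEquiv.ulift.symm, ClassSize.CentralProduct.cs_eq]
    norm_num
  · intro G _ _ h
    exact (ClassSize.eq_one_and_normal_of_cs_succ le_rfl (h.trans (by norm_num))).2
  · intro G _ _ h
    exact (ClassSize.eq_one_and_normal_of_cs_add_two le_rfl odd_one (h.trans (by norm_num))).2
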